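/- Let $n\ge 1$ and let $\mathbb F$ be a field whose characteristic $p$ satisfies $p=0$ or $p>n$, and $p\neq 2$ (the last condition is automatic for $n\ge 2$). Setting. Let $V=\{\alpha_1,\bar\alpha_1,\dots,\alpha_n,\bar\alpha_n\}$ be a set of $2n$ vertices, with $\bar{\bar\alpha}_i=\alpha_i$. A face is a subset $x\subseteq V$ with $|x\cap\{\alpha_i,\bar\alpha_i\}|\le 1$ for all $i$; for $0\le k\le n$ let $L^n_k$ be the set of faces with $k$ elements, $M^n_k=\mathbb F L^n_k$ the vector space with basis $L^n_k$, and $M^n=\bigoplus_{k=0}^n M^n_k$. The hyperoctahedral group $B_n$ of all permutations $g$ of $V$ with $g(\bar\beta)=\overline{g(\beta)}$ for all $\beta\in V$ permutes the faces, and so $M^n$ and the $M^n_k$ are $\mathbb F B_n$-modules. Define linear maps on $M^n$ by giving their values on faces $x$: $\epsilon(x)$ is the sum of all faces $y\supset x$ with $|y|=|x|+1$; $\partial(x)$ is the sum of all faces $z\subset x$ with $|z|=|x|-1$; $\sigma(x)=\sum_{\gamma\in x}\big((x\setminus\{\gamma\})\cup\{\bar\gamma\}\big)$; and $\nu^+=\partial\epsilon$.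 Let $\epsilon_k,\partial_k,\sigma_k,\nu^+_k$ be their restrictions to $M^n_k$. For disjoint $a,b\subseteq\{\alpha_1,\dots,\alpha_n\}$ let $[a,b]\in M^n$ be the expansion of the product $\prod_{\alpha\in a}(\alpha+\bar\alpha)\prod_{\beta\in b}(\beta-\bar\beta)$, where a product of vertices denotes the face consisting of them. For $0\le j\le k\le n$ let $E_{k,j}\subseteq M^n_k$ be the span of all $[a,b]$ with $a\cap b=\emptyset$, $|a|=k-j$, $|b|=j$. For $0\le i\le\min\{k-j,n-k\}$ let $$E_{k,j,i}=\{f\in E_{k,j}:\nu^+(f)=\lambda_{k,j,i}f\},\qquad \lambda_{k,j,i}=2(k-j+1-i)(n-k-i).$$ Theorem. The following hold. (1) For $0\le k\le n$ the map $\sigma_k$ sends $M^n_k$ to itself, its eigenvalues on $M^n_k$ are the pairwise distinct elements $k-2j$ of $\mathbb F$, $0\le j\le k$, the eigenspace for $k-2j$ is $E_{k,j}$, and $M^n_k=\bigoplus_{j=0}^k E_{k,j}$. (2) For $0\le j\le k\le n$ the map $\nu^+_k$ sends $E_{k,j}$ to itself, its eigenvalues on $E_{k,j}$ are the pairwise distinct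 elements $\lambda_{k,j,i}$ of $\mathbb F$, $0\le i\le\min\{k-j,n-k\}$, with eigenspaces $E_{k,j,i}$, and $E_{k,j}=\bigoplus_{i=0}^{\min\{k-j,n-k\}}E_{k,j,i}$. (3) The $M^n_k$, $E_{k,j}$ and $E_{k,j,i}$ are $B_n$-submodules of $M^n$. For all $0\le j\le k\le n$ and $0\le i\le\min\{k-j,n-k\}$ the $\mathbb F B_n$-module $E_{k,j,i}$ is irreducible. (4) For all $0\le j\le k\le n$, $0\le i\le\min\{k-j,n-k\}$ and $0\le j'\le k'\le n$, $0\le i'\le\min\{k'-j',n-k'\}$, the $\mathbb F B_n$-modules $E_{k,j,i}$ and $E_{k',j',i'}$ are isomorphic if and only if $j=j'$ and $i=i'$. In particular, for fixed $k$ the $E_{k,j,i}$ are pairwise non-isomorphic. (5) For $0\le k\le n$ the module $M^n_k$ is multiplicity free, that is, it is semisimple and distinct irreducible submodules of it are not isomorphic. (6) The maps $\epsilon_k$, $\partial_k$ and the identity maps $\mathrm{id}_{M^n_k}$, $0\le k\le n$, each extended by zero to the other summands of $M^n$, generate as an $\mathbb F$-algebra the algebra $\mathrm{Hom}_{B_n}(M^n)$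 of all linear maps $M^n\to M^n$ that commute with $B_n$. -/

import Mathlib

/-! ## Faces of the hyperoctahedron -/

/-- The `2n` vertices of the `n`-dimensional hyperoctahedron: `(i, true)` is the vertex `αᵢ` and
`(i, false)` is the opposite vertex `ᾱᵢ`. -/
abbrev Vertex (n : ℕ) : Type := Fin n × Bool

/-- The opposite vertex. -/
def opp {n : ℕ} (v : Vertex n) : Vertex n := (v.1, !v.2)

theorem opp_opp {n : ℕ} (v : Vertex n) : opp (opp v) = v := by simp [opp]

/-- A set of vertices is a face if it contains at most one vertex of each pair `{αᵢ, ᾱᵢ}`. -/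
def IsFace {n : ℕ} (x : Finset (Vertex n)) : Prop := ∀ v ∈ x, opp v ∉ x

instance {n : ℕ} (x : Finset (Vertex n)) : Decidable (IsFace x) :=
  inferInstanceAs (Decidable (∀ v ∈ x, opp v ∉ x))

/-- The set `L^n` of all faces. -/
abbrev Face (n : ℕ) : Type := {x : Finset (Vertex n) // IsFace x}

/-- The size of a face; `x` is a `k`-face if `x.size = k`. -/
def Face.size {n : ℕ} (x : Face n) : ℕ := x.1.card

/-- The face `(x \ {γ}) ∪ {γ̄}` for a vertex `γ` of the face `x`. -/
def Face.flip {n : ℕ} (x : Face n) (γ : Vertex n) : Face n :=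
  ⟨insert (opp γ) (x.1.erase γ), by
    intro v hv hv'
    have hx := x.2
    simp only [Finset.mem_insert, Finset.mem_erase] at hv hv'
    have hne : ∀ w : Vertex n, opp w ≠ w := by
      intro w h
      have h2 := congrArg Prod.snd h
      simp [opp] at h2
    rcases hv with rfl | ⟨h1, h2⟩
    · rcases hv' with h | ⟨h, -⟩
      · exact hne _ h
      · exact h (opp_opp γ)
    · rcases hv' with h | ⟨-, h⟩
      · apply h1
        rw [← opp_opp v, h, opp_opp]
      · exact hx v h2 h⟩

/-! ## The hyperoctahedral group and its face module -/

/-- The hyperoctahedral group `B_n`: all permutations of the vertices that commute with the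
passage to the opposite vertex. -/
def Hyperoct (n : ℕ) : Subgroup (Equiv.Perm (Vertex n)) where
  carrier := {g | ∀ v, g (opp v) = opp (g v)}
  one_mem' := fun _ => rfl
  mul_mem' := by
    intro g h hg hh v
    change g (h (opp v)) = opp (g (h v))
    rw [hh v, hg (h v)]
  inv_mem' := by
    intro g hg v
    apply g.injective
    rw [hg (g⁻¹ v)]
    change g (g.symm (opp v)) = opp (g (g.symm v))
    rw [g.apply_symm_apply, g.apply_symm_apply]

/-- The action of `B_n` on faces, `{β₁, …, β_k} ↦ {g β₁, …, g β_k}`. -/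
instance (n : ℕ) : MulAction (Hyperoct n) (Face n) where
  smul g x := ⟨x.1.map g.1.toEmbedding, by
    intro v hv hv'
    obtain ⟨w, hw, rfl⟩ := Finset.mem_map.1 hv
    obtain ⟨u, hu, hu'⟩ := Finset.mem_map.1 hv'
    have h : u = opp w := g.1.injective (hu'.trans (g.2 w).symm)
    exact x.2 w hw (h ▸ hu)⟩
  one_smul x := by
    apply Subtype.ext
    exact Finset.map_refl
  mul_smul g h x := by
    apply Subtype.ext
    change x.1.map _ = (x.1.map _).map _
    rw [Finset.map_map]
    rfl

/-- The face module `M^n = F L^n`, the vector space with basis `L^n`. -/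
abbrev FaceModule (F : Type*) [Field F] (n : ℕ) : Type _ := Face n →₀ F

/-- The permutation representation of `B_n` on `M^n`. -/
noncomputable def faceRep (F : Type*) [Field F] (n : ℕ) :
    Representation F (Hyperoct n) (FaceModule F n) where
  toFun g := Finsupp.lmapDomain F F (fun x : Face n => g • x)
  map_one' := by
    refine Finsupp.lhom_ext fun x c => ?_
    simp [Finsupp.mapDomain_single]
  map_mul' g h := by
    refine Finsupp.lhom_ext fun x c => ?_
    simp [Module.End.mul_apply, Finsupp.mapDomain_single, mul_smul]

/-- The submodule `M^n_k = F L^n_k` of `M^n` spanned by the `k`-faces. -/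
noncomputable def faceSub (F : Type*) [Field F] (n k : ℕ) : Submodule F (FaceModule F n) :=
  Finsupp.supported F F {x : Face n | x.size = k}

/-! ## The incidence maps -/

/-- `ε`: a face is sent to the sum of the faces that contain it and have one vertex more. -/
noncomputable def epsMap (F : Type*) [Field F] (n : ℕ) : Module.End F (FaceModule F n) :=
  Finsupp.linearCombination F fun x : Face n =>
    ∑ y : Face n with x.1 ⊆ y.1 ∧ y.size = x.size + 1, Finsupp.single y (1 : F)

/-- `∂`: a face is sent to the sum of the faces that it contains and that have one vertex less. -/
noncomputable def delMap (F : Type*) [Field F] (n : ℕ) : Module.End F (FaceModule F n) :=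
  Finsupp.linearCombination F fun x : Face n =>
    ∑ z : Face n with z.1 ⊆ x.1 ∧ z.size + 1 = x.size, Finsupp.single z (1 : F)

/-- `σ`: a face `x` is sent to the sum over `γ ∈ x` of the faces `(x \ {γ}) ∪ {γ̄}`. -/
noncomputable def sigmaMap (F : Type*) [Field F] (n : ℕ) : Module.End F (FaceModule F n) :=
  Finsupp.linearCombination F fun x : Face n =>
    ∑ γ ∈ x.1, Finsupp.single (x.flip γ) (1 : F)

/-- `ν⁺ = ∂ ε`. -/
noncomputable def nuPlus (F : Type*) [Field F] (n : ℕ) : Module.End F (FaceModule F n) :=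
  delMap F n ∘ₗ epsMap F n

/-- The projection of `M^n = ⨁ M^n_k` onto `M^n_k`, i.e. the identity map of `M^n_k` extended by
zero to the other summands. -/
noncomputable def idAt (F : Type*) [Field F] (n k : ℕ) : Module.End F (FaceModule F n) :=
  Finsupp.linearCombination F fun x : Face n =>
    if x.size = k then Finsupp.single x (1 : F) else 0

/-- `ε_k : M^n_k → M^n_{k+1}`, extended by zero to the other summands of `M^n`. -/
noncomputable def epsAt (F : Type*) [Field F] (n k : ℕ) : Module.End F (FaceModule F n) :=
  epsMap F n ∘ₗ idAt F n k

/-- `∂_k : M^n_k → M^n_{k-1}`, extended by zero to the other summands of `M^n`. -/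
noncomputable def delAt (F : Type*) [Field F] (n k : ℕ) : Module.End F (FaceModule F n) :=
  delMap F n ∘ₗ idAt F n k

/-! ## The spectral components -/

/-- The face with index set `s` whose barred vertices are those with index in `c`. -/
def signedFace {n : ℕ} (s c : Finset (Fin n)) : Face n :=
  ⟨s.image fun i => (i, decide (i ∉ c)), by
    intro v hv hv'
    obtain ⟨i, -, rfl⟩ := Finset.mem_image.1 hv
    obtain ⟨j, -, hj⟩ := Finset.mem_image.1 hv'
    simp only [opp, Prod.mk.injEq] at hj
    obtain ⟨rfl, h⟩ := hj
    simp at h⟩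

/-- For disjoint `a`, `b`, the element
`[a, b] = ∏_{α ∈ a} (α + ᾱ) ∏_{β ∈ b} (β - β̄)` of `M^n`, written as the expanded product: `c` is
the set of indices at which the barred vertex is chosen. -/
noncomputable def bracket (F : Type*) [Field F] {n : ℕ} (a b : Finset (Fin n)) :
    FaceModule F n :=
  ∑ c ∈ (a ∪ b).powerset, Finsupp.single (signedFace (a ∪ b) c) ((-1 : F) ^ (c ∩ b).card)

/-- `E_{k,j}`: the span of all `[a, b]` with `a`, `b` disjoint, `|a| = k - j` and `|b| = j`. -/
noncomputable def specE (F : Type*) [Field F] (n k j : ℕ) : Submodule F (FaceModule F n) :=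
  Submodule.span F {f | ∃ a b : Finset (Fin n),
    Disjoint a b ∧ a.card + j = k ∧ b.card = j ∧ f = bracket F a b}

/-- `λ_{k,j,i} = 2 (k - j + 1 - i) (n - k - i)`. -/
def specLam (F : Type*) [Field F] (n k j i : ℕ) : F :=
  2 * ((k : F) - j + 1 - i) * ((n : F) - k - i)

/-- `E_{k,j,i}`: the eigenspace of `ν⁺` on `E_{k,j}` for `λ_{k,j,i}`. -/
noncomputable def specEI (F : Type*) [Field F] (n k j i : ℕ) : Submodule F (FaceModule F n) :=
  specE F n k j ⊓ Module.End.eigenspace (nuPlus F n) (specLam F n k j i)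

/-! ## Notions used in the theorem -/

/-- `T` maps `W` to itself, the `lam s` are pairwise distinct, they are eigenvalues of the
restriction of `T` to `W`, with eigenspaces `U s`, and `W` is the direct sum of these eigenspaces
(so that there are no other eigenvalues). -/
def IsEigenspaceDecomposition {F V : Type*} [Field F] [AddCommGroup V] [Module F V]
    (T : Module.End F V) (W : Submodule F V) {m : ℕ} (lam : Fin m → F)
    (U : Fin m → Submodule F V) : Prop :=
  W ≤ W.comap T ∧ Function.Injective lam ∧
    (∀ s, U s = W ⊓ Module.End.eigenspace T (lam s)) ∧ (∀ s, U s ≠ ⊥) ∧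
    iSupIndep U ∧ ⨆ s, U s = W

/-- A representation is multiplicity free if it is semisimple (every subrepresentation has a
complement) and distinct irreducible subrepresentations are never isomorphic. -/
def IsMultiplicityFree {F G V : Type*} [Field F] [Monoid G] [AddCommGroup V] [Module F V]
    (ρ : Representation F G V) : Prop :=
  ρ.IsSemisimpleRepresentation ∧
    ∀ S T : Subrepresentation ρ,
      S.toRepresentation.IsIrreducible → T.toRepresentation.IsIrreducible →
        Nonempty (S.toRepresentation.Equiv T.toRepresentation) → S = T

/-! View `M^n` as the `n`-th tensor power of the space with basis `∅`, `α`, `ᾱ`. Then `ε`, `∂`, `σ`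
and the degree operator `N` are sums over the tensor positions of one `3 × 3` matrix, so their
commutators are computed from those matrices: `[σ, ε] = ε`, `[σ, ∂] = -∂` and `[∂, ε] = 2n - 3N -
σ`.

Inverting the expansion of the products `[a, b]`, which needs `2 ≠ 0`, shows that the `E_{k,j}` span
`M_k`. They lie in eigenspaces of `σ` for distinct eigenvalues, so they are those eigenspaces. On
`E_{k,j}` the commutator `[∂, ε]` is the scalar `2(n - 2k + j)`, so for fixed `j` the maps `ε` and
`∂` form an `sl₂`-like ladder. They carry `E_{k,j,i}` to `E_{k+1,j,i}` and back, and the composites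
are multiplication by `λ_{k,j,i}`, nonzero for `j + i ≤ k < n - i`. Splitting off the kernel of `∂`
going up to the middle level, and that of `ε` going down to it, gives the spectral decomposition of
`ν⁺` (`iSup_specEI`). Explicit vectors killed by `∂` at level `j + i`, pushed up by `ε`, show that
no component vanishes (`specEI_ne_bot`).

Representation theory enters by a count. An equivariant endomorphism has matrix entries constant on
the `B_n`-orbits of pairs of faces, and these orbits inject into the pairs of components with equal
`j` and `i` (`finrank_equivariantEnd_le`). Conversely each such pair gives an operator in the
algebra generated by `ε_k`, `∂_k`, `id_k`: project to the first component, then move to the second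
by a power of `ε` or `∂`. These operators are linearly independent, so the two algebras coincide and
equivariant maps act between components by scalar multiples of the links
(`eq_and_scalar_of_finrank_le`).

Since `|B_n|` is invertible in `F`, Maschke averaging extends equivariant maps on submodules to all
of `M^n`. Irreducibility, the isomorphism criterion and multiplicity freeness then follow from the
scalar description. -/

/-! ### Faces as words in three letters -/

namespace Face

/-- The sign of the vertex of `x` with index `i`, if there is one. -/
def coord {n : ℕ} (x : Face n) (i : Fin n) : Option Bool :=
  if (i, true) ∈ x.1 then some true else if (i, false) ∈ x.1 then some false else none

/-- The face with given coordinates. -/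
def ofCoord {n : ℕ} (c : Fin n → Option Bool) : Face n :=
  ⟨Finset.univ.filter fun v => c v.1 = some v.2, by
    intro v hv hv'
    simp only [Finset.mem_filter, Finset.mem_univ, true_and, opp] at hv hv'
    rw [hv] at hv'
    simp at hv'⟩

theorem mem_iff_coord {n : ℕ} (x : Face n) (v : Vertex n) : v ∈ x.1 ↔ x.coord v.1 = some v.2 := by
  obtain ⟨i, b⟩ := v
  have h := x.2 (i, true)
  simp only [opp, Bool.not_true] at h
  unfold coord
  cases b <;> by_cases h1 : (i, true) ∈ x.1 <;> by_cases h2 : (i, false) ∈ x.1 <;> simp_all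

theorem mem_ofCoord {n : ℕ} (c : Fin n → Option Bool) (v : Vertex n) :
    v ∈ (ofCoord c).1 ↔ c v.1 = some v.2 := by
  simp [ofCoord]

@[simp]
theorem coord_ofCoord {n : ℕ} (c : Fin n → Option Bool) : (ofCoord c).coord = c := by
  funext i
  refine Option.ext fun b => ?_
  rw [← mem_iff_coord (ofCoord c) (i, b), mem_ofCoord]

theorem coord_injective {n : ℕ} : Function.Injective (coord (n := n)) := by
  intro x y h
  apply Subtype.ext
  ext v
  rw [mem_iff_coord, mem_iff_coord, h]

@[simp]
theorem ofCoord_coord {n : ℕ} (x : Face n) : ofCoord x.coord = x :=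
  coord_injective (coord_ofCoord _)

/-- The face obtained from `x` by changing the coordinate `i` to `o`. -/
def setCoord {n : ℕ} (x : Face n) (i : Fin n) (o : Option Bool) : Face n :=
  ofCoord (Function.update x.coord i o)

@[simp]
theorem coord_setCoord_self {n : ℕ} (x : Face n) (i : Fin n) (o : Option Bool) :
    (x.setCoord i o).coord i = o := by
  simp [setCoord]

theorem coord_setCoord_of_ne {n : ℕ} (x : Face n) {i j : Fin n} (h : j ≠ i) (o : Option Bool) :
    (x.setCoord i o).coord j = x.coord j := by
  simp [setCoord, h]

@[simp]
theorem setCoord_setCoord {n : ℕ} (x : Face n) (i : Fin n) (o o' : Option Bool) :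
    (x.setCoord i o).setCoord i o' = x.setCoord i o' := by
  simp [setCoord]

@[simp]
theorem setCoord_coord {n : ℕ} (x : Face n) (i : Fin n) : x.setCoord i (x.coord i) = x := by
  simp [setCoord]

theorem setCoord_comm {n : ℕ} (x : Face n) {i j : Fin n} (h : i ≠ j) (o o' : Option Bool) :
    (x.setCoord i o).setCoord j o' = (x.setCoord j o').setCoord i o := by
  simp [setCoord, Function.update_comm h]

theorem size_eq_sum {n : ℕ} (x : Face n) :
    x.size = ∑ i, if x.coord i = none then 0 else 1 := by
  have : x.size = ∑ v : Vertex n, if v ∈ x.1 then 1 else 0 := by simp [size]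
  rw [this, Fintype.sum_prod_type]
  refine Finset.sum_congr rfl fun i _ => ?_
  simp only [mem_iff_coord, Fintype.sum_bool]
  rcases x.coord i with _ | _ | _ <;> simp

theorem size_le {n : ℕ} (x : Face n) : x.size ≤ n := by
  rw [size_eq_sum]
  calc _ ≤ ∑ _i : Fin n, 1 := Finset.sum_le_sum fun i _ => by split_ifs <;> simp
    _ = n := by simp

theorem setCoord_some_val {n : ℕ} (x : Face n) (i : Fin n) (b : Bool) (h : x.coord i = none) :
    (x.setCoord i (some b)).1 = insert (i, b) x.1 := by
  ext ⟨j, c⟩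
  rw [mem_iff_coord, Finset.mem_insert, mem_iff_coord]
  by_cases hj : j = i
  · subst hj
    simp [h, eq_comm]
  · simp [coord_setCoord_of_ne x hj, hj]

theorem setCoord_none_val {n : ℕ} (x : Face n) (i : Fin n) (b : Bool) (h : x.coord i = some b) :
    (x.setCoord i none).1 = x.1.erase (i, b) := by
  ext ⟨j, c⟩
  rw [mem_iff_coord, Finset.mem_erase, mem_iff_coord]
  by_cases hj : j = i
  · subst hj
    simp only [coord_setCoord_self, h]
    simp [eq_comm]
  · simp [coord_setCoord_of_ne x hj, hj]

theorem flip_eq_setCoord {n : ℕ} (x : Face n) (v : Vertex n) (h : v ∈ x.1) :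
    x.flip v = x.setCoord v.1 (some (!v.2)) := by
  obtain ⟨i, b⟩ := v
  rw [mem_iff_coord] at h
  apply Subtype.ext
  rw [← setCoord_setCoord x i none, setCoord_some_val _ _ _ (by simp),
    setCoord_none_val x i b h]
  rfl

end Face

/-! ### Operators on tensor factors and their commutators -/

section Local

variable {F : Type*} [Field F] {n : ℕ}

/-- The action of a `3 × 3` matrix on the `i`-th tensor factor of `M^n`, viewed as the `n`-th
tensor power of the space with basis `∅`, `α`, `ᾱ`. -/
noncomputable def loc (F : Type*) [Field F] {n : ℕ} (i : Fin n) :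
    Matrix (Option Bool) (Option Bool) F →ₐ[F] Module.End F (FaceModule F n) :=
  AlgHom.ofLinearMap
    { toFun := fun A => Finsupp.linearCombination F fun x : Face n =>
        ∑ o, A o (x.coord i) • Finsupp.single (x.setCoord i o) (1 : F)
      map_add' := fun A B => by
        refine Finsupp.lhom_ext fun x c => ?_
        simp only [LinearMap.add_apply, Finsupp.linearCombination_single, Matrix.add_apply,
          add_smul, Finset.sum_add_distrib, smul_add]
      map_smul' := fun r A => by
        refine Finsupp.lhom_ext fun x c => ?_
        simp only [LinearMap.smul_apply, Finsupp.linearCombination_single, Matrix.smul_apply,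
          RingHom.id_apply, smul_assoc, Finset.smul_sum]
        exact Finset.sum_congr rfl fun o _ => smul_comm _ _ _ }
    (by
      refine Finsupp.lhom_ext' fun x => LinearMap.ext_ring ?_
      simp only [LinearMap.comp_apply, Finsupp.lsingle_apply, LinearMap.coe_mk, AddHom.coe_mk,
        Finsupp.linearCombination_single, one_smul, Module.End.one_apply]
      rw [Finset.sum_eq_single (x.coord i)] <;> simp +contextual)
    (fun A B => by
      refine Finsupp.lhom_ext fun x c => ?_
      simp only [LinearMap.coe_mk, AddHom.coe_mk, Module.End.mul_apply,
        Finsupp.linearCombination_single, map_smul, map_sum, one_smul, Face.coord_setCoord_self,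
        Face.setCoord_setCoord, Matrix.mul_apply, Finset.sum_smul, Finset.smul_sum]
      rw [Finset.sum_comm]
      refine Finset.sum_congr rfl fun o _ => Finset.sum_congr rfl fun o' _ => ?_
      simp only [smul_smul]
      ring_nf)

theorem loc_single (i : Fin n) (A : Matrix (Option Bool) (Option Bool) F) (x : Face n) :
    loc F i A (Finsupp.single x 1) =
      ∑ o, A o (x.coord i) • Finsupp.single (x.setCoord i o) (1 : F) := by
  change Finsupp.linearCombination F _ _ = _
  simp

theorem loc_commute {i j : Fin n} (h : i ≠ j) (A B : Matrix (Option Bool) (Option Bool) F) :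
    loc F i A * loc F j B = loc F j B * loc F i A := by
  refine Finsupp.lhom_ext' fun x => LinearMap.ext_ring ?_
  simp only [LinearMap.comp_apply, Finsupp.lsingle_apply, Module.End.mul_apply, loc_single,
    map_sum, map_smul, Face.coord_setCoord_of_ne x h, Face.coord_setCoord_of_ne x h.symm,
    Finset.smul_sum]
  rw [Finset.sum_comm]
  refine Finset.sum_congr rfl fun o _ => Finset.sum_congr rfl fun o' _ => ?_
  rw [smul_comm, Face.setCoord_comm x h]

/-- The derivation-like extension of a `3 × 3` matrix to `M^n`. -/
noncomputable def tot (F : Type*) [Field F] (n : ℕ) :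
    Matrix (Option Bool) (Option Bool) F →ₗ[F] Module.End F (FaceModule F n) :=
  ∑ i : Fin n, (loc F i).toLinearMap

theorem tot_apply (A : Matrix (Option Bool) (Option Bool) F) : tot F n A = ∑ i, loc F i A := by
  simp [tot]

theorem sum_mul_eq_of_commute {R ι : Type*} [Ring R] [Fintype ι] (a : ι → R) (x : R) (s : ι)
    (h : ∀ i, i ≠ s → a i * x = x * a i) :
    (∑ i, a i) * x = x * (∑ i, a i) + (a s * x - x * a s) := by
  rw [Finset.sum_mul, Finset.mul_sum, ← sub_eq_iff_eq_add', ← Finset.sum_sub_distrib,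
    Finset.sum_eq_single s]
  · intro i _ hi
    rw [h i hi, sub_self]
  · simp

/-- Operators at different positions commute, so only the `s`-th summand contributes a commutator.
-/
theorem tot_mul_loc (A X : Matrix (Option Bool) (Option Bool) F) (s : Fin n) :
    tot F n A * loc F s X = loc F s X * tot F n A + loc F s (A * X - X * A) := by
  rw [tot_apply, map_sub, map_mul, map_mul]
  exact sum_mul_eq_of_commute (R := Module.End F (FaceModule F n)) (fun i => loc F i A)
    (loc F s X) s fun i hi => loc_commute hi A X

theorem tot_commutator (A B : Matrix (Option Bool) (Option Bool) F) :
    tot F n A * tot F n B = tot F n B * tot F n A + tot F n (A * B - B * A) := by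
  conv_lhs => rw [tot_apply B, Finset.mul_sum]
  simp only [tot_mul_loc, Finset.sum_add_distrib, ← Finset.sum_mul, ← tot_apply]

theorem tot_one : tot F n 1 = (n : F) • 1 := by
  simp [tot_apply, Nat.cast_smul_eq_nsmul]

/-- Adding a vertex. -/
def matEps (F : Type*) [Field F] : Matrix (Option Bool) (Option Bool) F := fun o c =>
  if c = none ∧ o ≠ none then 1 else 0

/-- Removing a vertex. -/
def matDel (F : Type*) [Field F] : Matrix (Option Bool) (Option Bool) F := fun o c =>
  if c ≠ none ∧ o = none then 1 else 0

/-- Passing to the opposite vertex. -/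
def matSig (F : Type*) [Field F] : Matrix (Option Bool) (Option Bool) F := fun o c =>
  if c ≠ none ∧ o = c.map not then 1 else 0

/-- The projection on the faces that have a vertex. -/
def matNum (F : Type*) [Field F] : Matrix (Option Bool) (Option Bool) F := fun o c =>
  if c ≠ none ∧ o = c then 1 else 0

/-- Adding the difference of two opposite vertices. -/
def matDiff (F : Type*) [Field F] : Matrix (Option Bool) (Option Bool) F := fun o c =>
  if c = none ∧ o = some true then 1 else if c = none ∧ o = some false then -1 else 0

/-- A face covering `x` arises by filling exactly one empty index; this exhibits `ε` as a sum of
local operators. -/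
theorem sum_coord_eq_none {M : Type*} [AddCommMonoid M] (x : Face n) (f : Face n → M) :
    ∑ y : Face n with x.1 ⊆ y.1 ∧ y.size = x.size + 1, f y =
      ∑ v : Vertex n with x.coord v.1 = none, f (x.setCoord v.1 (some v.2)) := by
  symm
  refine Finset.sum_bij (fun v _ => x.setCoord v.1 (some v.2)) ?_ ?_ ?_ (fun _ _ => rfl)
  · intro v hv
    simp only [Finset.mem_filter, Finset.mem_univ, true_and] at hv ⊢
    have hn : v ∉ x.1 := by rw [Face.mem_iff_coord, hv]; simp
    rw [Face.size, Face.setCoord_some_val _ _ _ hv]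
    exact ⟨Finset.subset_insert _ _, Finset.card_insert_of_notMem hn⟩
  · intro v hv w hw h
    simp only [Finset.mem_filter, Finset.mem_univ, true_and] at hv hw
    have h1 : v ∈ (x.setCoord v.1 (some v.2)).1 := by
      rw [Face.setCoord_some_val _ _ _ hv]; exact Finset.mem_insert_self _ _
    rw [h, Face.setCoord_some_val _ _ _ hw, Finset.mem_insert] at h1
    refine h1.resolve_right fun h2 => ?_
    rw [Face.mem_iff_coord, hv] at h2
    simp at h2
  · intro y hy
    simp only [Finset.mem_filter, Finset.mem_univ, true_and] at hy
    obtain ⟨v, hv, hvy⟩ := Finset.exists_eq_insert_iff.2 ⟨hy.1, hy.2.symm⟩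
    have hc : x.coord v.1 = none := by
      rw [Option.eq_none_iff_forall_ne_some]
      intro b hb
      have hb' : (v.1, b) ∈ x.1 := (Face.mem_iff_coord x (v.1, b)).2 hb
      have h1 : (v.1, b) ∈ y.1 := hy.1 hb'
      have h2 : v ∈ y.1 := hvy ▸ Finset.mem_insert_self _ _
      rw [Face.mem_iff_coord] at h1 h2
      have : b = v.2 := by simpa [h2, eq_comm] using h1
      exact hv ((Face.mem_iff_coord x v).2 (by rw [hb, this]))
    refine ⟨v, by simpa using hc, Subtype.ext ?_⟩
    rw [Face.setCoord_some_val _ _ _ hc, hvy]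

theorem sum_subset_face {M : Type*} [AddCommMonoid M] (x : Face n) (f : Face n → M) :
    ∑ z : Face n with z.1 ⊆ x.1 ∧ z.size + 1 = x.size, f z =
      ∑ v ∈ x.1, f (x.setCoord v.1 none) := by
  symm
  refine Finset.sum_bij (fun v _ => x.setCoord v.1 none) ?_ ?_ ?_ (fun _ _ => rfl)
  · intro v hv
    have hc := (Face.mem_iff_coord x v).1 hv
    simp only [Finset.mem_filter, Finset.mem_univ, true_and]
    rw [Face.size, Face.setCoord_none_val _ _ _ hc]
    exact ⟨Finset.erase_subset _ _, Finset.card_erase_add_one hv⟩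
  · intro v hv w hw h
    have h1 : v ∉ (x.setCoord v.1 none).1 := by
      rw [Face.setCoord_none_val _ _ _ ((Face.mem_iff_coord x v).1 hv)]
      exact Finset.notMem_erase _ _
    rw [h, Face.setCoord_none_val _ _ _ ((Face.mem_iff_coord x w).1 hw)] at h1
    by_contra hne
    exact h1 (Finset.mem_erase.2 ⟨hne, hv⟩)
  · intro z hz
    simp only [Finset.mem_filter, Finset.mem_univ, true_and] at hz
    obtain ⟨v, hv, hvy⟩ := Finset.exists_eq_insert_iff.2 hz
    have hvx : v ∈ x.1 := hvy ▸ Finset.mem_insert_self _ _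
    refine ⟨v, hvx, Subtype.ext ?_⟩
    rw [Face.setCoord_none_val _ _ _ ((Face.mem_iff_coord x v).1 hvx), ← hvy]
    exact Finset.erase_insert hv

theorem sum_mem_face {M : Type*} [AddCommMonoid M] (x : Face n) (f : Vertex n → M) :
    ∑ v ∈ x.1, f v = ∑ i, ∑ b, if x.coord i = some b then f (i, b) else 0 := by
  rw [← Fintype.sum_prod_type', ← Finset.sum_filter]
  refine Finset.sum_congr ?_ fun _ _ => rfl
  ext v
  simp [Face.mem_iff_coord]

theorem epsMap_eq : epsMap F n = tot F n (matEps F) := by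
  refine Finsupp.lhom_ext' fun x => LinearMap.ext_ring ?_
  simp only [LinearMap.comp_apply, Finsupp.lsingle_apply, epsMap,
    Finsupp.linearCombination_single, one_smul, sum_coord_eq_none, tot_apply, LinearMap.sum_apply,
    loc_single]
  rw [Finset.sum_filter, Fintype.sum_prod_type]
  refine Finset.sum_congr rfl fun i _ => ?_
  rcases h : x.coord i with _ | b <;> simp [Fintype.sum_option, matEps, h]

theorem delMap_eq : delMap F n = tot F n (matDel F) := by
  refine Finsupp.lhom_ext' fun x => LinearMap.ext_ring ?_
  simp only [LinearMap.comp_apply, Finsupp.lsingle_apply, delMap,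
    Finsupp.linearCombination_single, one_smul, sum_subset_face, tot_apply, LinearMap.sum_apply,
    loc_single]
  rw [sum_mem_face]
  refine Finset.sum_congr rfl fun i _ => ?_
  rcases x.coord i with _ | _ | _ <;> simp [matDel]

theorem sigmaMap_eq : sigmaMap F n = tot F n (matSig F) := by
  refine Finsupp.lhom_ext' fun x => LinearMap.ext_ring ?_
  simp only [LinearMap.comp_apply, Finsupp.lsingle_apply, sigmaMap,
    Finsupp.linearCombination_single, one_smul, tot_apply, LinearMap.sum_apply,
    loc_single]
  rw [Finset.sum_congr rfl fun v hv => by rw [Face.flip_eq_setCoord x v hv], sum_mem_face]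
  refine Finset.sum_congr rfl fun i _ => ?_
  rcases x.coord i with _ | _ | _ <;> simp [matSig]

theorem tot_matNum_single (x : Face n) :
    tot F n (matNum F) (Finsupp.single x 1) = (x.size : F) • Finsupp.single x 1 := by
  rw [Face.size_eq_sum, tot_apply, LinearMap.sum_apply, Nat.cast_sum, Finset.sum_smul]
  refine Finset.sum_congr rfl fun i _ => ?_
  rw [loc_single]
  conv_rhs => rw [← Face.setCoord_coord x i]
  rcases x.coord i with _ | _ | _ <;> simp [matNum]

theorem tot_matNum_apply (f : FaceModule F n) (x : Face n) :
    tot F n (matNum F) f x = (x.size : F) * f x := by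
  induction f using Finsupp.induction_linear with
  | zero => simp
  | add f g hf hg => simp [hf, hg, mul_add]
  | single y c =>
    have : Finsupp.single y c = c • Finsupp.single y (1 : F) := by simp
    rw [this, map_smul, tot_matNum_single]
    by_cases h : y = x
    · subst h; simp; ring
    · simp [h]

theorem matSig_commutator_matEps :
    matSig F * matEps F - matEps F * matSig F = matEps F := by
  ext o c
  rcases o with _ | _ | _ <;> rcases c with _ | _ | _ <;>
    simp [Matrix.mul_apply, Fintype.sum_option, matSig, matEps]

theorem matSig_commutator_matDel :
    matSig F * matDel F - matDel F * matSig F = -matDel F := by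
  ext o c
  rcases o with _ | _ | _ <;> rcases c with _ | _ | _ <;>
    simp [Matrix.mul_apply, matSig, matDel]

/-- On `∅` the product `∂ε` is `2`; on the span of `α`, `ᾱ` the product `ε∂` is the all-ones block,
that is, identity plus flip. Rewriting the projection to `∅` as `1 - matNum` gives the coefficient
`3`. -/
theorem matDel_commutator_matEps :
    matDel F * matEps F - matEps F * matDel F =
      (2 : F) • 1 - (3 : F) • matNum F - matSig F := by
  ext o c
  rcases o with _ | _ | _ <;> rcases c with _ | _ | _ <;>
    simp [Matrix.mul_apply, Fintype.sum_option, matSig, matDel, matEps, matNum] <;> norm_num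

theorem matNum_commutator_matEps :
    matNum F * matEps F - matEps F * matNum F = matEps F := by
  ext o c
  rcases o with _ | _ | _ <;> rcases c with _ | _ | _ <;>
    simp [Matrix.mul_apply, Fintype.sum_option, matEps, matNum]

theorem sigmaMap_mul_epsMap :
    sigmaMap F n * epsMap F n = epsMap F n * sigmaMap F n + epsMap F n := by
  rw [sigmaMap_eq, epsMap_eq, tot_commutator, matSig_commutator_matEps]

theorem sigmaMap_mul_delMap :
    sigmaMap F n * delMap F n = delMap F n * sigmaMap F n - delMap F n := by
  rw [sigmaMap_eq, delMap_eq, tot_commutator, matSig_commutator_matDel, map_neg]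
  exact (sub_eq_add_neg _ _).symm

theorem delMap_mul_epsMap :
    delMap F n * epsMap F n = epsMap F n * delMap F n +
      ((2 * n : F) • 1 - (3 : F) • tot F n (matNum F) - sigmaMap F n) := by
  rw [sigmaMap_eq, delMap_eq, epsMap_eq, tot_commutator, matDel_commutator_matEps]
  simp only [map_sub, map_smul, tot_one, smul_smul]

end Local

/-! ### The grading by face size -/

section Graded

variable {F : Type*} [Field F] {n : ℕ}

theorem mem_faceSub {k : ℕ} {f : FaceModule F n} :
    f ∈ faceSub F n k ↔ ∀ x, f x ≠ 0 → x.size = k := by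
  rw [faceSub, Finsupp.mem_supported]
  simp [Set.subset_def]

theorem single_mem_faceSub (x : Face n) (c : F) : Finsupp.single x c ∈ faceSub F n x.size :=
  Finsupp.single_mem_supported F c rfl

theorem faceSub_le_of_single {k : ℕ} {U : Submodule F (FaceModule F n)}
    (h : ∀ x : Face n, x.size = k → Finsupp.single x (1 : F) ∈ U) : faceSub F n k ≤ U := by
  rw [faceSub, Finsupp.supported_eq_span_single, Submodule.span_le]
  rintro _ ⟨x, hx, rfl⟩
  exact h x hx

theorem faceSub_eq_bot {k : ℕ} (hk : n < k) : faceSub F n k = ⊥ := by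
  rw [eq_bot_iff]
  refine faceSub_le_of_single fun x hx => ?_
  have := x.size_le
  omega

theorem tot_matNum_of_mem {k : ℕ} {f : FaceModule F n} (hf : f ∈ faceSub F n k) :
    tot F n (matNum F) f = (k : F) • f := by
  ext x
  rw [tot_matNum_apply, Finsupp.smul_apply, smul_eq_mul]
  by_cases h : f x = 0
  · simp [h]
  · rw [mem_faceSub.1 hf x h]

theorem cast_injOn (hF : ∀ m : ℕ, 0 < m → m ≤ n → (m : F) ≠ 0) {k l : ℕ} (hk : k ≤ n)
    (hl : l ≤ n) (h : (k : F) = l) : k = l := by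
  by_contra hne
  wlog hlt : k < l generalizing k l
  · exact this hl hk h.symm (Ne.symm hne) (by omega)
  refine hF (l - k) (by omega) (by omega) ?_
  rw [Nat.cast_sub hlt.le, h, sub_self]

/-- The degrees `0, …, n` stay distinct in `F`, so the eigenvalue of `N` detects the level. This
locates vectors built by local operators. -/
theorem mem_faceSub_of_tot_matNum (hF : ∀ m : ℕ, 0 < m → m ≤ n → (m : F) ≠ 0) {k : ℕ}
    (hk : k ≤ n) {f : FaceModule F n} (h : tot F n (matNum F) f = (k : F) • f) :
    f ∈ faceSub F n k := by
  refine mem_faceSub.2 fun x hx => cast_injOn hF x.size_le hk ?_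
  have := DFunLike.congr_fun h x
  rw [tot_matNum_apply, Finsupp.smul_apply, smul_eq_mul] at this
  exact mul_right_cancel₀ hx this

theorem epsMap_single (x : Face n) : epsMap F n (Finsupp.single x 1) =
    ∑ y : Face n with x.1 ⊆ y.1 ∧ y.size = x.size + 1, Finsupp.single y (1 : F) := by
  simp [epsMap]

theorem delMap_single (x : Face n) : delMap F n (Finsupp.single x 1) =
    ∑ z : Face n with z.1 ⊆ x.1 ∧ z.size + 1 = x.size, Finsupp.single z (1 : F) := by
  simp [delMap]

theorem sigmaMap_single (x : Face n) : sigmaMap F n (Finsupp.single x 1) =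
    ∑ γ ∈ x.1, Finsupp.single (x.flip γ) (1 : F) := by
  simp [sigmaMap]

theorem idAt_single (k : ℕ) (x : Face n) : idAt F n k (Finsupp.single x 1) =
    if x.size = k then Finsupp.single x (1 : F) else 0 := by
  simp [idAt]

theorem epsMap_mem {k : ℕ} {f : FaceModule F n} (hf : f ∈ faceSub F n k) :
    epsMap F n f ∈ faceSub F n (k + 1) := by
  revert f
  change faceSub F n k ≤ (faceSub F n (k + 1)).comap (epsMap F n)
  refine faceSub_le_of_single fun x hx => ?_
  rw [Submodule.mem_comap, epsMap_single]
  refine Submodule.sum_mem _ fun y hy => ?_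
  rw [← hx, ← (Finset.mem_filter.1 hy).2.2]
  exact single_mem_faceSub y 1

theorem delMap_mem {k : ℕ} {f : FaceModule F n} (hf : f ∈ faceSub F n (k + 1)) :
    delMap F n f ∈ faceSub F n k := by
  revert f
  change faceSub F n (k + 1) ≤ (faceSub F n k).comap (delMap F n)
  refine faceSub_le_of_single fun x hx => ?_
  rw [Submodule.mem_comap, delMap_single]
  refine Submodule.sum_mem _ fun y hy => ?_
  have := (Finset.mem_filter.1 hy).2.2
  rw [hx, Nat.add_right_cancel_iff] at this
  rw [← this]
  exact single_mem_faceSub y 1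

theorem delMap_eq_zero {f : FaceModule F n} (hf : f ∈ faceSub F n 0) : delMap F n f = 0 := by
  revert f
  change faceSub F n 0 ≤ LinearMap.ker (delMap F n)
  refine faceSub_le_of_single fun x hx => ?_
  rw [LinearMap.mem_ker, delMap_single, hx]
  simp

theorem idAt_apply (k : ℕ) (f : FaceModule F n) (x : Face n) :
    idAt F n k f x = if x.size = k then f x else 0 := by
  induction f using Finsupp.induction_linear with
  | zero => simp
  | add f g hf hg => simp only [map_add, Finsupp.add_apply, hf, hg]; split_ifs <;> simp
  | single y c =>
    have : Finsupp.single y c = c • Finsupp.single y (1 : F) := by simp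
    rw [this, map_smul, idAt_single]
    by_cases h : y = x
    · subst h; split_ifs <;> simp
    · split_ifs <;> simp [h]

theorem idAt_mem (k : ℕ) (f : FaceModule F n) : idAt F n k f ∈ faceSub F n k := by
  refine mem_faceSub.2 fun x hx => ?_
  rw [idAt_apply] at hx
  by_contra h
  exact hx (if_neg h)

theorem idAt_of_mem {k : ℕ} {f : FaceModule F n} (hf : f ∈ faceSub F n k) : idAt F n k f = f := by
  ext x
  rw [idAt_apply]
  split_ifs with h
  · rfl
  · by_contra h'
    exact h (mem_faceSub.1 hf x (Ne.symm h'))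

theorem idAt_of_mem_of_ne {k l : ℕ} (h : l ≠ k) {f : FaceModule F n} (hf : f ∈ faceSub F n l) :
    idAt F n k f = 0 := by
  ext x
  rw [idAt_apply]
  split_ifs with hx
  · by_contra h'
    exact h ((mem_faceSub.1 hf x h').symm.trans hx)
  · rfl

theorem sum_idAt : ∑ k ∈ Finset.range (n + 1), idAt F n k = 1 := by
  refine LinearMap.ext fun f => ?_
  ext x
  rw [LinearMap.sum_apply, Finsupp.finsetSum_apply]
  simp only [idAt_apply, Finset.sum_ite_eq, Finset.mem_range, Module.End.one_apply]
  rw [if_pos (Nat.lt_succ_of_le x.size_le)]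

end Graded

/-! ### The products `[a, b]` as eigenvectors of `σ` -/

section Bracket

variable {F : Type*} [Field F] {n : ℕ}

theorem coord_signedFace (s c : Finset (Fin n)) (i : Fin n) :
    (signedFace s c).coord i = if i ∈ s then some (decide (i ∉ c)) else none := by
  refine Option.ext fun b => ?_
  rw [← Face.mem_iff_coord (signedFace s c) (i, b)]
  simp only [signedFace, Finset.mem_image, Prod.mk.injEq]
  split_ifs with h
  · constructor
    · rintro ⟨j, _, rfl, rfl⟩; rfl
    · intro hb; exact ⟨i, h, rfl, Option.some.inj hb⟩
  · constructor
    · rintro ⟨j, hj, rfl, rfl⟩; exact absurd hj h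
    · intro hb; simp at hb

theorem size_signedFace (s c : Finset (Fin n)) : (signedFace s c).size = s.card :=
  Finset.card_image_of_injective _ fun _ _ h => (Prod.ext_iff.1 h).1

theorem exists_eq_signedFace (x : Face n) :
    ∃ s c : Finset (Fin n), c ⊆ s ∧ x = signedFace s c := by
  refine ⟨Finset.univ.filter fun i => x.coord i ≠ none,
    Finset.univ.filter fun i => x.coord i = some false, ?_, Face.coord_injective ?_⟩
  · intro i
    simp only [Finset.mem_filter, Finset.mem_univ, true_and]
    intro h
    simp [h]
  · funext i
    rw [coord_signedFace]
    rcases h : x.coord i with _ | _ | _ <;> simp [h]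

theorem flip_signedFace (s c : Finset (Fin n)) {i : Fin n} (hi : i ∈ s) :
    (signedFace s c).flip (i, decide (i ∉ c)) = signedFace s (symmDiff c {i}) := by
  rw [Face.flip_eq_setCoord]
  · refine Face.coord_injective (funext fun j => ?_)
    by_cases hj : j = i
    · subst hj
      simp [coord_signedFace, hi, Finset.mem_symmDiff]
    · rw [Face.coord_setCoord_of_ne _ hj]
      simp [coord_signedFace, Finset.mem_symmDiff, hj]
  · rw [Face.mem_iff_coord, coord_signedFace, if_pos hi]

theorem sigmaMap_signedFace (s c : Finset (Fin n)) :
    sigmaMap F n (Finsupp.single (signedFace s c) 1) =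
      ∑ i ∈ s, Finsupp.single (signedFace s (symmDiff c {i})) (1 : F) := by
  rw [sigmaMap_single]
  have : (signedFace s c).1 = s.image fun i => (i, decide (i ∉ c)) := rfl
  rw [this, Finset.sum_image (fun i _ j _ h => (Prod.ext_iff.1 h).1)]
  exact Finset.sum_congr rfl fun i hi => by rw [flip_signedFace s c hi]

theorem neg_one_pow_symmDiff (b c : Finset (Fin n)) (i : Fin n) :
    (-1 : F) ^ (symmDiff c {i} ∩ b).card = (if i ∈ b then -1 else 1) * (-1) ^ (c ∩ b).card := by
  by_cases hb : i ∈ b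
  · rw [if_pos hb]
    by_cases hc : i ∈ c
    · have h : c ∩ b = insert i (symmDiff c {i} ∩ b) := by
        ext j; simp only [Finset.mem_inter, Finset.mem_insert, Finset.mem_symmDiff,
          Finset.mem_singleton]; grind
      rw [h, Finset.card_insert_of_notMem (by simp [Finset.mem_symmDiff, hc]), pow_succ]
      ring
    · have h : symmDiff c {i} ∩ b = insert i (c ∩ b) := by
        ext j; simp only [Finset.mem_inter, Finset.mem_insert, Finset.mem_symmDiff,
          Finset.mem_singleton]; grind
      rw [h, Finset.card_insert_of_notMem (by simp [hc]), pow_succ]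
      ring
  · rw [if_neg hb, one_mul]
    congr 2
    ext j; simp only [Finset.mem_inter, Finset.mem_symmDiff, Finset.mem_singleton]; grind

/-- Flipping at index `i` permutes the terms of the expansion by toggling `i` in `c`. The sign
changes exactly when `i ∈ b`, so each index of `a` contributes `1` and each index of `b` contributes
`-1`. -/
theorem sigmaMap_bracket {a b : Finset (Fin n)} (hab : Disjoint a b) :
    sigmaMap F n (bracket F a b) = ((a.card : F) - b.card) • bracket F a b := by
  have hs : ∀ (x : Face n) (c : F), Finsupp.single x c = c • Finsupp.single x (1 : F) := by simp
  have key : ∀ i ∈ a ∪ b, ∑ c ∈ (a ∪ b).powerset, (-1 : F) ^ (c ∩ b).card •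
      Finsupp.single (signedFace (a ∪ b) (symmDiff c {i})) (1 : F) =
      (if i ∈ b then (-1 : F) else 1) • bracket F a b := by
    intro i hi
    rw [bracket, Finset.smul_sum]
    refine Finset.sum_nbij' (fun c => symmDiff c {i}) (fun c => symmDiff c {i}) ?_ ?_ ?_ ?_ ?_
    · intro c hc
      rw [Finset.mem_powerset] at hc ⊢
      intro j hj
      rcases Finset.mem_symmDiff.1 hj with h | h
      · exact hc h.1
      · rw [Finset.mem_singleton.1 h.1]; exact hi
    · intro c hc
      rw [Finset.mem_powerset] at hc ⊢
      intro j hj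
      rcases Finset.mem_symmDiff.1 hj with h | h
      · exact hc h.1
      · rw [Finset.mem_singleton.1 h.1]; exact hi
    · intro c _; exact symmDiff_symmDiff_cancel_right _ _
    · intro c _; exact symmDiff_symmDiff_cancel_right _ _
    · intro c _
      rw [neg_one_pow_symmDiff, hs _ (_ * _), smul_smul]
      congr 1
      split_ifs <;> ring
  have h1 : sigmaMap F n (bracket F a b) = ∑ i ∈ a ∪ b, (if i ∈ b then (-1 : F) else 1) •
      bracket F a b := by
    rw [← Finset.sum_congr rfl key, Finset.sum_comm]
    conv_lhs => rw [bracket]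
    rw [map_sum]
    refine Finset.sum_congr rfl fun c _ => ?_
    rw [hs, map_smul, sigmaMap_signedFace, Finset.smul_sum]
  rw [h1, ← Finset.sum_smul, Finset.sum_union hab]
  congr 1
  rw [Finset.sum_congr rfl fun i hi => if_neg (Finset.disjoint_left.1 hab hi),
    Finset.sum_congr rfl fun i (hi : i ∈ b) => if_pos hi]
  simp [sub_eq_add_neg]

theorem bracket_mem_faceSub {a b : Finset (Fin n)} (hab : Disjoint a b) :
    bracket F a b ∈ faceSub F n (a.card + b.card) := by
  refine Submodule.sum_mem _ fun c _ => ?_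
  rw [← Finset.card_union_of_disjoint hab, ← size_signedFace (a ∪ b) c]
  exact single_mem_faceSub _ _

/-- Orthogonality of the characters of `(ℤ/2)^s`: the sum factors over `s`, and an index at which
`c` and `d` differ gives the factor `1 - 1`. -/
theorem sum_neg_one_pow_mul {s c d : Finset (Fin n)} (hc : c ⊆ s) (hd : d ⊆ s) :
    ∑ b ∈ s.powerset, (-1 : F) ^ (c ∩ b).card * (-1) ^ (d ∩ b).card =
      if d = c then 2 ^ s.card else 0 := by
  have hpow : ∀ e b : Finset (Fin n),
      (-1 : F) ^ (e ∩ b).card = ∏ i ∈ b, if i ∈ e then -1 else 1 := by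
    intro e b
    rw [Finset.prod_ite, Finset.prod_const, Finset.prod_const, one_pow, mul_one,
      Finset.filter_mem_eq_inter, Finset.inter_comm]
  simp only [hpow, ← Finset.prod_mul_distrib]
  rw [← Finset.prod_one_add]
  split_ifs with h
  · subst h
    rw [← Finset.prod_const]
    refine Finset.prod_congr rfl fun i _ => ?_
    split_ifs <;> norm_num
  · obtain ⟨i, hi⟩ : ∃ i, ¬ (i ∈ d ↔ i ∈ c) := by
      by_contra hn
      push Not at hn
      exact h (Finset.ext hn)
    have his : i ∈ s := by
      by_contra hs
      exact hi ⟨fun h => absurd (hd h) hs, fun h => absurd (hc h) hs⟩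
    refine Finset.prod_eq_zero his ?_
    by_cases h1 : i ∈ c <;> by_cases h2 : i ∈ d <;> simp_all

/-- Fourier inversion on the faces with index set `s`. Dividing by `2 ^ s.card` expresses a face by
brackets, hence the `E_{k,j}` span `M_k`. -/
theorem sum_bracket (s c : Finset (Fin n)) (hc : c ⊆ s) :
    ∑ b ∈ s.powerset, (-1 : F) ^ (c ∩ b).card • bracket F (s \ b) b =
      (2 : F) ^ s.card • Finsupp.single (signedFace s c) (1 : F) := by
  have h1 : ∀ b ∈ s.powerset, (-1 : F) ^ (c ∩ b).card • bracket F (s \ b) b =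
      ∑ d ∈ s.powerset, ((-1 : F) ^ (c ∩ b).card * (-1) ^ (d ∩ b).card) •
        Finsupp.single (signedFace s d) (1 : F) := by
    intro b hb
    rw [bracket, Finset.sdiff_union_of_subset (Finset.mem_powerset.1 hb), Finset.smul_sum]
    refine Finset.sum_congr rfl fun d _ => ?_
    rw [Finsupp.smul_single, Finsupp.smul_single, smul_eq_mul, smul_eq_mul, mul_one]
  rw [Finset.sum_congr rfl h1, Finset.sum_comm]
  simp only [← Finset.sum_smul]
  rw [Finset.sum_eq_single c]
  · rw [sum_neg_one_pow_mul hc hc, if_pos rfl]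
  · intro d hd hne
    rw [sum_neg_one_pow_mul hc (Finset.mem_powerset.1 hd), if_neg hne, zero_smul]
  · intro h; exact absurd (Finset.mem_powerset.2 hc) h

theorem bracket_mem_specE {a b : Finset (Fin n)} (hab : Disjoint a b) :
    bracket F a b ∈ specE F n (a.card + b.card) b.card :=
  Submodule.subset_span ⟨a, b, hab, rfl, rfl, rfl⟩

theorem specE_le_faceSub (k j : ℕ) : specE F n k j ≤ faceSub F n k := by
  rw [specE, Submodule.span_le]
  rintro _ ⟨a, b, hab, hk, hj, rfl⟩
  rw [← hk, ← hj]
  exact bracket_mem_faceSub hab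

theorem specE_le_eigenspace (k j : ℕ) :
    specE F n k j ≤ Module.End.eigenspace (sigmaMap F n) ((k : F) - 2 * (j : F)) := by
  rw [specE, Submodule.span_le]
  rintro _ ⟨a, b, hab, hk, hj, rfl⟩
  rw [SetLike.mem_coe, Module.End.mem_eigenspace_iff, sigmaMap_bracket hab, ← hk, hj]
  congr 1
  push_cast
  ring

theorem specE_eq_bot {k j : ℕ} (h : k < j ∨ n < k) : specE F n k j = ⊥ := by
  rcases h with h | h
  · rw [specE, Submodule.span_eq_bot]
    rintro _ ⟨a, b, -, hk, -, -⟩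
    omega
  · rw [eq_bot_iff, ← faceSub_eq_bot (F := F) h]
    exact specE_le_faceSub k j

theorem faceSub_le_iSup_specE (h2 : (2 : F) ≠ 0) (k : ℕ) :
    faceSub F n k ≤ ⨆ j : Fin (k + 1), specE F n k j := by
  refine faceSub_le_of_single fun x hx => ?_
  obtain ⟨s, c, hc, rfl⟩ := exists_eq_signedFace x
  rw [size_signedFace] at hx
  have h := sum_bracket (F := F) s c hc
  rw [← Submodule.smul_mem_iff _ (pow_ne_zero s.card h2), ← h]
  refine Submodule.sum_mem _ fun b hb => Submodule.smul_mem _ _ ?_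
  have hbs := Finset.mem_powerset.1 hb
  have hcard := Finset.card_sdiff_add_card_eq_card hbs
  have hm := bracket_mem_specE (F := F) (Finset.sdiff_disjoint (t := s) (s := b))
  rw [hcard, hx] at hm
  exact Submodule.mem_iSup_of_mem (⟨b.card, by omega⟩ : Fin (k + 1)) hm

end Bracket

/-! ### Linear algebra of eigenspace decompositions -/

section Decomposition

variable {F V : Type*} [Field F] [AddCommGroup V] [Module F V]

/-- Subspaces of eigenspaces for distinct eigenvalues that span are the full eigenspaces. -/
theorem eq_inf_eigenspace_of_iSup_eq {ι : Type*} {T : Module.End F V} {W : Submodule F V}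
    {lam : ι → F} {U : ι → Submodule F V} (hlam : Function.Injective lam)
    (hU : ∀ s, U s ≤ Module.End.eigenspace T (lam s)) (hW : ⨆ s, U s = W) :
    iSupIndep U ∧ ∀ s, U s = W ⊓ Module.End.eigenspace T (lam s) := by
  have hind : iSupIndep fun s => Module.End.eigenspace T (lam s) :=
    (Module.End.eigenspaces_iSupIndep T).comp hlam
  refine ⟨hind.mono hU, fun s => le_antisymm (le_inf (hW ▸ le_iSup U s) (hU s)) ?_⟩
  rintro v ⟨hv, hvs⟩
  -- Split `v` into its part `u` in `U s` and the rest `w`. Then `w = v - u` lies both in the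
  -- eigenspace for `lam s` and in the span of the other ones, so it vanishes.
  rw [SetLike.mem_coe, ← hW, iSup_split_single U s, Submodule.mem_sup] at hv
  obtain ⟨u, hu, w, hw, rfl⟩ := hv
  have hw' : w ∈ ⨆ t, ⨆ (_ : t ≠ s), Module.End.eigenspace T (lam t) :=
    iSup₂_mono (fun t _ => hU t) hw
  have hws : w ∈ Module.End.eigenspace T (lam s) := by
    have := Submodule.sub_mem _ hvs (hU s hu)
    simpa using this
  have : w = 0 := by
    have := (hind s).le_bot ⟨hws, hw'⟩
    simpa using this
  rw [this, add_zero]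
  exact hu

theorem isEigenspaceDecomposition_of_iSup_eq {T : Module.End F V} {W : Submodule F V} {m : ℕ}
    {lam : Fin m → F} {U : Fin m → Submodule F V} (hlam : Function.Injective lam)
    (hU : ∀ s, U s ≤ Module.End.eigenspace T (lam s)) (hne : ∀ s, U s ≠ ⊥)
    (hW : ⨆ s, U s = W) : IsEigenspaceDecomposition T W lam U := by
  obtain ⟨h1, h2⟩ := eq_inf_eigenspace_of_iSup_eq hlam hU hW
  refine ⟨?_, hlam, h2, hne, h1, hW⟩
  conv_lhs => rw [← hW]
  refine iSup_le fun s v hv => ?_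
  rw [Submodule.mem_comap, Module.End.mem_eigenspace_iff.1 (hU s hv), ← hW]
  exact Submodule.smul_mem _ _ (Submodule.mem_iSup_of_mem s hv)

end Decomposition

/-! ### `E_{k,j}` as a full eigenspace of `σ` -/

section SpecE

variable {F : Type*} [Field F] {n : ℕ}

theorem sigma_eigenvalue_injective (hF : ∀ m : ℕ, 0 < m → m ≤ n → (m : F) ≠ 0) (h2 : (2 : F) ≠ 0)
    {m : ℕ} (hm : m ≤ n) (c : F) :
    Function.Injective fun j : Fin (m + 1) => c - 2 * ((j : ℕ) : F) := by
  intro j j' h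
  have : ((j : ℕ) : F) = (j' : ℕ) := mul_left_cancel₀ h2 (sub_right_injective h)
  exact Fin.ext (cast_injOn hF (by omega) (by omega) this)

theorem iSup_specE (h2 : (2 : F) ≠ 0) {k m : ℕ} (hm : k ≤ m) :
    ⨆ j : Fin (m + 1), specE F n k j = faceSub F n k :=
  le_antisymm (iSup_le fun j => specE_le_faceSub k j)
    ((faceSub_le_iSup_specE h2 k).trans
      (iSup_le fun j => le_iSup_of_le (⟨j, by omega⟩ : Fin (m + 1)) le_rfl))

/-- The range is `j ≤ n` rather than `j ≤ k`: for `j > k` the span `E_{k,j}` is zero, and this case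
shows below that `∂` kills `E_{j,j}`. -/
theorem specE_eq (hF : ∀ m : ℕ, 0 < m → m ≤ n → (m : F) ≠ 0) (h2 : (2 : F) ≠ 0)
    {k j : ℕ} (hk : k ≤ n) (hj : j ≤ n) :
    specE F n k j =
      faceSub F n k ⊓ Module.End.eigenspace (sigmaMap F n) ((k : F) - 2 * (j : F)) :=
  (eq_inf_eigenspace_of_iSup_eq (sigma_eigenvalue_injective hF h2 le_rfl (k : F))
    (fun j : Fin (n + 1) => specE_le_eigenspace k j) (iSup_specE h2 hk)).2 ⟨j, by omega⟩

end SpecE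

/-! ### The ladder of `ε` and `∂`, and the spectrum of `ν⁺` -/

section Ladder

variable {F : Type*} [Field F] {n : ℕ}

theorem mem_specE_iff (hF : ∀ m : ℕ, 0 < m → m ≤ n → (m : F) ≠ 0) (h2 : (2 : F) ≠ 0)
    {k j : ℕ} (hk : k ≤ n) (hj : j ≤ n) {f : FaceModule F n} :
    f ∈ specE F n k j ↔
      f ∈ faceSub F n k ∧ sigmaMap F n f = ((k : F) - 2 * (j : F)) • f := by
  rw [specE_eq hF h2 hk hj, Submodule.mem_inf, Module.End.mem_eigenspace_iff]

theorem epsMap_mem_specE (hF : ∀ m : ℕ, 0 < m → m ≤ n → (m : F) ≠ 0) (h2 : (2 : F) ≠ 0)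
    {k j : ℕ} (hj : j ≤ n) {f : FaceModule F n} (hf : f ∈ specE F n k j) :
    epsMap F n f ∈ specE F n (k + 1) j := by
  have hm := epsMap_mem (specE_le_faceSub k j hf)
  rcases Nat.lt_or_ge n (k + 1) with hk | hk
  · rw [faceSub_eq_bot hk, Submodule.mem_bot] at hm
    rw [hm]
    exact Submodule.zero_mem _
  · rw [mem_specE_iff hF h2 (by omega) hj] at hf
    rw [mem_specE_iff hF h2 hk hj]
    refine ⟨hm, ?_⟩
    have := LinearMap.congr_fun (sigmaMap_mul_epsMap (F := F) (n := n)) f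
    rw [LinearMap.add_apply, Module.End.mul_apply, Module.End.mul_apply, hf.2, map_smul] at this
    rw [this]
    push_cast
    module

theorem delMap_mem_specE (hF : ∀ m : ℕ, 0 < m → m ≤ n → (m : F) ≠ 0) (h2 : (2 : F) ≠ 0)
    {k j : ℕ} (hk : k + 1 ≤ n) (hj : j ≤ n) {f : FaceModule F n}
    (hf : f ∈ specE F n (k + 1) j) : delMap F n f ∈ specE F n k j := by
  rw [mem_specE_iff hF h2 hk hj] at hf
  rw [mem_specE_iff hF h2 (by omega) hj]
  refine ⟨delMap_mem hf.1, ?_⟩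
  have := LinearMap.congr_fun (sigmaMap_mul_delMap (F := F) (n := n)) f
  rw [LinearMap.sub_apply, Module.End.mul_apply, Module.End.mul_apply, hf.2, map_smul] at this
  rw [this]
  push_cast
  module

theorem nuPlus_apply (f : FaceModule F n) : nuPlus F n f = delMap F n (epsMap F n f) := rfl

/-- The commutator of `∂` and `ε` is a scalar on `E_{k,j}`. -/
theorem nuPlus_of_mem_specE {k j : ℕ} {f : FaceModule F n} (hf : f ∈ specE F n k j) :
    nuPlus F n f = epsMap F n (delMap F n f) + (2 * ((n : F) - 2 * k + j)) • f := by
  have := LinearMap.congr_fun (delMap_mul_epsMap (F := F) (n := n)) f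
  simp only [LinearMap.add_apply, LinearMap.sub_apply, LinearMap.smul_apply, Module.End.mul_apply,
    Module.End.one_apply, tot_matNum_of_mem (specE_le_faceSub k j hf),
    Module.End.mem_eigenspace_iff.1 (specE_le_eigenspace k j hf)] at this
  rw [nuPlus_apply, this]
  module

theorem mem_specEI_iff {k j i : ℕ} {f : FaceModule F n} :
    f ∈ specEI F n k j i ↔ f ∈ specE F n k j ∧ nuPlus F n f = specLam F n k j i • f := by
  rw [specEI, Submodule.mem_inf, Module.End.mem_eigenspace_iff]

theorem specEI_le_specE (k j i : ℕ) : specEI F n k j i ≤ specE F n k j := inf_le_left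

/-- The increment is the scalar of `[∂, ε]` on `E_{k+1,j}`. Hence `ε∂` on level `k + 1` has the
eigenvalue of `∂ε` on level `k`, with the same `i`. -/
theorem specLam_succ (k j i : ℕ) :
    specLam F n (k + 1) j i = specLam F n k j i + 2 * ((n : F) - 2 * (k + 1) + j) := by
  simp only [specLam]
  push_cast
  ring

theorem epsMap_mem_specEI (hF : ∀ m : ℕ, 0 < m → m ≤ n → (m : F) ≠ 0) (h2 : (2 : F) ≠ 0)
    {k j i : ℕ} (hj : j ≤ n) {f : FaceModule F n} (hf : f ∈ specEI F n k j i) :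
    epsMap F n f ∈ specEI F n (k + 1) j i := by
  rw [mem_specEI_iff] at hf ⊢
  have hm := epsMap_mem_specE hF h2 hj hf.1
  refine ⟨hm, ?_⟩
  rw [nuPlus_of_mem_specE hm, ← nuPlus_apply, hf.2, specLam_succ, map_smul]
  push_cast
  module

theorem delMap_mem_specEI (hF : ∀ m : ℕ, 0 < m → m ≤ n → (m : F) ≠ 0) (h2 : (2 : F) ≠ 0)
    {k j i : ℕ} (hk : k + 1 ≤ n) (hj : j ≤ n) {f : FaceModule F n}
    (hf : f ∈ specEI F n (k + 1) j i) : delMap F n f ∈ specEI F n k j i := by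
  rw [mem_specEI_iff] at hf ⊢
  refine ⟨delMap_mem_specE hF h2 hk hj hf.1, ?_⟩
  have h := nuPlus_of_mem_specE hf.1
  rw [hf.2, specLam_succ] at h
  have h' : epsMap F n (delMap F n f) = specLam F n k j i • f := by
    rw [← sub_eq_iff_eq_add] at h
    rw [← h]
    push_cast
    module
  rw [nuPlus_apply, h', map_smul]

theorem epsMap_delMap_of_mem {k j i : ℕ} {f : FaceModule F n}
    (hf : f ∈ specEI F n (k + 1) j i) :
    epsMap F n (delMap F n f) = specLam F n k j i • f := by
  rw [mem_specEI_iff] at hf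
  have h := nuPlus_of_mem_specE hf.1
  rw [hf.2, specLam_succ] at h
  rw [← sub_eq_iff_eq_add] at h
  rw [← h]
  push_cast
  module

/-- If `∂f = 0`, then `ν⁺` reduces to the commutator scalar `2(n - 2k + j)`, which is `λ_{k,j,i}` at
`i = k - j`. -/
theorem mem_specEI_of_delMap_eq_zero {k j : ℕ} (hj : j ≤ k) {f : FaceModule F n}
    (hf : f ∈ specE F n k j) (h0 : delMap F n f = 0) : f ∈ specEI F n k j (k - j) := by
  rw [mem_specEI_iff]
  refine ⟨hf, ?_⟩
  rw [nuPlus_of_mem_specE hf, h0, map_zero, zero_add, specLam, Nat.cast_sub hj]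
  congr 1
  ring

theorem mem_specEI_of_epsMap_eq_zero {k j : ℕ} (hk : k ≤ n) {f : FaceModule F n}
    (hf : f ∈ specE F n k j) (h0 : epsMap F n f = 0) : f ∈ specEI F n k j (n - k) := by
  rw [mem_specEI_iff]
  refine ⟨hf, ?_⟩
  rw [nuPlus_apply, h0, map_zero, specLam, Nat.cast_sub hk]
  module

/-- Both factors are images of integers between `1` and `n`. So `ε` is injective on each level of
the chain `j + i ≤ k ≤ n - i` except the top one, where the eigenvalue is `0`. -/
theorem specLam_ne_zero (hF : ∀ m : ℕ, 0 < m → m ≤ n → (m : F) ≠ 0) (h2 : (2 : F) ≠ 0)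
    {k j i : ℕ} (hj : j + i ≤ k) (hk : k + i < n) : specLam F n k j i ≠ 0 := by
  have h1 : (k : F) - j + 1 - i = ((k + 1 - j - i : ℕ) : F) := by
    rw [Nat.cast_sub (by omega), Nat.cast_sub (by omega)]
    push_cast
    ring
  have h3 : (n : F) - k - i = ((n - k - i : ℕ) : F) := by
    rw [Nat.cast_sub (by omega), Nat.cast_sub (by omega)]
  rw [specLam, h1, h3]
  exact mul_ne_zero (mul_ne_zero h2 (hF _ (by omega) (by omega))) (hF _ (by omega) (by omega))

/-- `λ_i - λ_{i'} = 2 (i' - i)(n + 1 - j - i - i')`, and the last factor is positive because `i + i'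
≤ (k - j) + (n - k)`. -/
theorem specLam_injective (hF : ∀ m : ℕ, 0 < m → m ≤ n → (m : F) ≠ 0) (h2 : (2 : F) ≠ 0)
    {k j i i' : ℕ} (hk : k ≤ n) (hj : j ≤ k) (hi : i ≤ min (k - j) (n - k))
    (hi' : i' ≤ min (k - j) (n - k)) (h : specLam F n k j i = specLam F n k j i') : i = i' := by
  by_contra hne
  wlog hlt : i < i' generalizing i i'
  · exact this hi' hi h.symm (Ne.symm hne) (by omega)
  have h1 : ((i' - i : ℕ) : F) = i' - i := Nat.cast_sub hlt.le
  have h3 : ((n + 1 - j - i - i' : ℕ) : F) = n + 1 - j - i - i' := by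
    rw [Nat.cast_sub (by omega), Nat.cast_sub (by omega), Nat.cast_sub (by omega)]
    push_cast
    ring
  refine mul_ne_zero (mul_ne_zero h2 (hF (i' - i) (by omega) (by omega)))
    (hF (n + 1 - j - i - i') (by omega) (by omega)) ?_
  rw [h1, h3]
  rw [specLam, specLam, ← sub_eq_zero] at h
  rw [← h]
  ring

/-- Levels at most `(n + j) / 2`: the decomposition is propagated upwards by `ε`. -/
theorem specE_le_iSup_of_le_half (hF : ∀ m : ℕ, 0 < m → m ≤ n → (m : F) ≠ 0) (h2 : (2 : F) ≠ 0)
    {j k : ℕ} (hj : j ≤ k) (hk : 2 * k ≤ n + j) (hkn : k ≤ n) :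
    specE F n k j ≤ ⨆ i : Fin (k - j + 1), specEI F n k j i := by
  induction k, hj using Nat.le_induction with
  | base =>
    intro f hf
    refine Submodule.mem_iSup_of_mem (0 : Fin (j - j + 1)) ?_
    have h0 : delMap F n f = 0 := by
      rcases Nat.eq_zero_or_pos j with rfl | hpos
      · exact delMap_eq_zero (specE_le_faceSub _ _ hf)
      · obtain ⟨m, rfl⟩ : ∃ m, j = m + 1 := ⟨j - 1, by omega⟩
        -- `∂` maps `E_{j,j}` into `E_{j-1,j}`, which is zero.
        have := delMap_mem_specE hF h2 hkn hkn hf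
        rwa [specE_eq_bot (by omega), Submodule.mem_bot] at this
    simpa using mem_specEI_of_delMap_eq_zero le_rfl hf h0
  | succ k hj ih =>
    intro f hf
    have hd := ih (by omega) (by omega) (delMap_mem_specE hF h2 hkn (by omega) hf)
    obtain ⟨g, hg, hsum⟩ := (Submodule.mem_iSup_iff_exists_finsupp _ _).1 hd
    have hsum' : ∑ i, g i = delMap F n f := by
      rw [← hsum, Finsupp.sum_fintype _ _ fun _ => rfl]
    -- Since `∂ε` is the scalar `λ_{k,j,i}` on `g i`, this `u` satisfies `∂u = ∂f`, and `f - u` is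
    -- killed by `∂`. The level bound gives `k + i < n` for all `i ≤ k - j`, so that the division is
    -- legitimate.
    set u : FaceModule F n := ∑ i : Fin (k - j + 1), (specLam F n k j i)⁻¹ • epsMap F n (g i)
      with hu
    have hE : ∀ i : Fin (k - j + 1), epsMap F n (g i) ∈ specEI F n (k + 1) j i := fun i =>
      epsMap_mem_specEI hF h2 (by omega) (hg i)
    have hum : u ∈ specE F n (k + 1) j := Submodule.sum_mem _ fun i _ =>
      Submodule.smul_mem _ _ (specEI_le_specE _ _ _ (hE i))
    have hdu : delMap F n u = delMap F n f := by
      rw [hu, map_sum, ← hsum']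
      refine Finset.sum_congr rfl fun i _ => ?_
      rw [map_smul, ← nuPlus_apply, (mem_specEI_iff.1 (hg i)).2, smul_smul,
        inv_mul_cancel₀ (specLam_ne_zero hF h2 (by omega) (by omega)), one_smul]
    have hr := mem_specEI_of_delMap_eq_zero (by omega) (Submodule.sub_mem _ hf hum)
      (by rw [map_sub, hdu, sub_self])
    rw [← sub_add_cancel f u]
    refine Submodule.add_mem _
      (Submodule.mem_iSup_of_mem (⟨k + 1 - j, by omega⟩ : Fin (k + 1 - j + 1)) hr)
      (Submodule.sum_mem _ fun i _ => Submodule.smul_mem _ _ ?_)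
    exact Submodule.mem_iSup_of_mem (⟨i, by omega⟩ : Fin (k + 1 - j + 1)) (hE i)

/-- Levels at least `(n + j) / 2`: the decomposition is propagated downwards by `∂`. -/
theorem specE_le_iSup_of_half_le (hF : ∀ m : ℕ, 0 < m → m ≤ n → (m : F) ≠ 0) (h2 : (2 : F) ≠ 0)
    {j m k : ℕ} (hm : k + m = n) (hj : j ≤ k) (hk : n + j ≤ 2 * k) :
    specE F n k j ≤ ⨆ i : Fin (m + 1), specEI F n k j i := by
  induction m generalizing k with
  | zero =>
    intro f hf
    refine Submodule.mem_iSup_of_mem (0 : Fin (0 + 1)) ?_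
    have h0 : epsMap F n f = 0 := by
      have := epsMap_mem (specE_le_faceSub _ _ hf)
      rwa [faceSub_eq_bot (by omega), Submodule.mem_bot] at this
    have := mem_specEI_of_epsMap_eq_zero (by omega) hf h0
    rwa [show n - k = 0 by omega] at this
  | succ m ih =>
    intro f hf
    have hd := ih (k := k + 1) (by omega) (by omega) (by omega)
      (epsMap_mem_specE hF h2 (by omega) hf)
    obtain ⟨g, hg, hsum⟩ := (Submodule.mem_iSup_iff_exists_finsupp _ _).1 hd
    have hsum' : ∑ i, g i = epsMap F n f := by
      rw [← hsum, Finsupp.sum_fintype _ _ fun _ => rfl]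
    -- The mirror image: `ε∂` is the scalar `λ_{k,j,i}` on level `k + 1`, so `εu = εf`. Here `n + j
    -- ≤ 2k` gives `j + i ≤ k` for all `i ≤ m`.
    set u : FaceModule F n := ∑ i : Fin (m + 1), (specLam F n k j i)⁻¹ • delMap F n (g i)
      with hu
    have hE : ∀ i : Fin (m + 1), delMap F n (g i) ∈ specEI F n k j i := fun i =>
      delMap_mem_specEI hF h2 (by omega) (by omega) (hg i)
    have hum : u ∈ specE F n k j := Submodule.sum_mem _ fun i _ =>
      Submodule.smul_mem _ _ (specEI_le_specE _ _ _ (hE i))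
    have hdu : epsMap F n u = epsMap F n f := by
      rw [hu, map_sum, ← hsum']
      refine Finset.sum_congr rfl fun i _ => ?_
      rw [map_smul, epsMap_delMap_of_mem (hg i), smul_smul,
        inv_mul_cancel₀ (specLam_ne_zero hF h2 (by omega) (by omega)), one_smul]
    have hr := mem_specEI_of_epsMap_eq_zero (by omega) (Submodule.sub_mem _ hf hum)
      (by rw [map_sub, hdu, sub_self])
    rw [← sub_add_cancel f u]
    refine Submodule.add_mem _
      (Submodule.mem_iSup_of_mem (⟨n - k, by omega⟩ : Fin (m + 1 + 1)) hr)
      (Submodule.sum_mem _ fun i _ => Submodule.smul_mem _ _ ?_)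
    exact Submodule.mem_iSup_of_mem (⟨i, by omega⟩ : Fin (m + 1 + 1)) (hE i)

theorem iSup_specEI (hF : ∀ m : ℕ, 0 < m → m ≤ n → (m : F) ≠ 0) (h2 : (2 : F) ≠ 0)
    {k j : ℕ} (hk : k ≤ n) (hj : j ≤ k) :
    ⨆ i : Fin (min (k - j) (n - k) + 1), specEI F n k j i = specE F n k j := by
  refine le_antisymm (iSup_le fun i => specEI_le_specE _ _ _) ?_
  rcases Nat.le_total (2 * k) (n + j) with h | h
  · refine (specE_le_iSup_of_le_half hF h2 hj h hk).trans (iSup_le fun i => ?_)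
    exact le_iSup_of_le (⟨i, by omega⟩ : Fin (min (k - j) (n - k) + 1)) le_rfl
  · refine (specE_le_iSup_of_half_le hF h2 (m := n - k) (by omega) hj h).trans
      (iSup_le fun i => ?_)
    exact le_iSup_of_le (⟨i, by omega⟩ : Fin (min (k - j) (n - k) + 1)) le_rfl

end Ladder

/-! ### Vectors killed by `∂`, and nonvanishing of the components -/

section Primitive

variable {F : Type*} [Field F] {n : ℕ}

/-- The projection on the empty face. -/
def matVac (F : Type*) [Field F] : Matrix (Option Bool) (Option Bool) F := fun o c =>
  if o = none ∧ c = none then 1 else 0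

/-- The condition `hw` says that index `s` is unused in `w`, so the local commutator matters only on
the column of `∅`. This lets products be built one fresh index at a time. -/
theorem tot_loc_of_vac {s : Fin n} {w : FaceModule F n} (hw : loc F s (matVac F) w = w)
    {D X Y : Matrix (Option Bool) (Option Bool) F}
    (h : (D * X - X * D) * matVac F = Y * matVac F) :
    tot F n D (loc F s X w) = loc F s X (tot F n D w) + loc F s Y w := by
  have h1 := LinearMap.congr_fun (tot_mul_loc D X s) w
  rw [LinearMap.add_apply, Module.End.mul_apply, Module.End.mul_apply] at h1
  rw [h1]
  congr 1
  rw [← hw, ← Module.End.mul_apply, ← Module.End.mul_apply, ← map_mul, ← map_mul, h]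

theorem loc_comm_apply {s t : Fin n} (h : s ≠ t) (A B : Matrix (Option Bool) (Option Bool) F)
    (w : FaceModule F n) : loc F s A (loc F t B w) = loc F t B (loc F s A w) :=
  LinearMap.congr_fun (loc_commute h A B) w

theorem loc_loc_of_vac {s : Fin n} {w : FaceModule F n} (hw : loc F s (matVac F) w = w)
    {A B Y : Matrix (Option Bool) (Option Bool) F} (h : A * B * matVac F = Y * matVac F) :
    loc F s A (loc F s B w) = loc F s Y w := by
  rw [← hw]
  simp only [← Module.End.mul_apply, ← map_mul]
  rw [← mul_assoc, h]

theorem delMap_loc_matDiff {s : Fin n} {w : FaceModule F n} (hw : loc F s (matVac F) w = w) :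
    delMap F n (loc F s (matDiff F) w) = loc F s (matDiff F) (delMap F n w) := by
  rw [delMap_eq, tot_loc_of_vac hw (Y := 0), map_zero, LinearMap.zero_apply, add_zero]
  ext o c
  rcases o with _ | _ | _ <;> rcases c with _ | _ | _ <;>
    simp [Matrix.mul_apply, Fintype.sum_option, matDel, matDiff, matVac]

theorem sigmaMap_loc_matDiff {s : Fin n} {w : FaceModule F n} (hw : loc F s (matVac F) w = w) :
    sigmaMap F n (loc F s (matDiff F) w) =
      loc F s (matDiff F) (sigmaMap F n w) - loc F s (matDiff F) w := by
  rw [sigmaMap_eq, tot_loc_of_vac hw (Y := -matDiff F), map_neg, LinearMap.neg_apply,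
    sub_eq_add_neg]
  ext o c
  rcases o with _ | _ | _ <;> rcases c with _ | _ | _ <;>
    simp [Matrix.mul_apply, Fintype.sum_option, matSig, matDiff, matVac]

theorem tot_matNum_loc_matDiff {s : Fin n} {w : FaceModule F n}
    (hw : loc F s (matVac F) w = w) :
    tot F n (matNum F) (loc F s (matDiff F) w) =
      loc F s (matDiff F) (tot F n (matNum F) w) + loc F s (matDiff F) w := by
  refine tot_loc_of_vac hw ?_
  ext o c
  rcases o with _ | _ | _ <;> rcases c with _ | _ | _ <;>
    simp [Matrix.mul_apply, Fintype.sum_option, matNum, matDiff, matVac]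

theorem delMap_loc_matEps {s : Fin n} {w : FaceModule F n} (hw : loc F s (matVac F) w = w) :
    delMap F n (loc F s (matEps F) w) = loc F s (matEps F) (delMap F n w) + (2 : F) • w := by
  rw [delMap_eq, tot_loc_of_vac hw (Y := (2 : F) • 1), map_smul, map_one, LinearMap.smul_apply,
    Module.End.one_apply]
  ext o c
  rcases o with _ | _ | _ <;> rcases c with _ | _ | _ <;>
    simp [Matrix.mul_apply, Fintype.sum_option, matDel, matEps, matVac]

theorem sigmaMap_loc_matEps {s : Fin n} {w : FaceModule F n} (hw : loc F s (matVac F) w = w) :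
    sigmaMap F n (loc F s (matEps F) w) =
      loc F s (matEps F) (sigmaMap F n w) + loc F s (matEps F) w := by
  rw [sigmaMap_eq]
  exact tot_loc_of_vac hw (by rw [matSig_commutator_matEps])

theorem tot_matNum_loc_matEps {s : Fin n} {w : FaceModule F n}
    (hw : loc F s (matVac F) w = w) :
    tot F n (matNum F) (loc F s (matEps F) w) =
      loc F s (matEps F) (tot F n (matNum F) w) + loc F s (matEps F) w :=
  tot_loc_of_vac hw (by rw [matNum_commutator_matEps])

/-- Undoing the addition of a vertex. -/
def matUndo (F : Type*) [Field F] : Matrix (Option Bool) (Option Bool) F := fun o c =>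
  if o = none ∧ c = some true then 1 else 0

theorem loc_matUndo_of_vac {s : Fin n} {w : FaceModule F n} (hw : loc F s (matVac F) w = w) :
    loc F s (matUndo F) w = 0 := by
  rw [← hw, ← Module.End.mul_apply, ← map_mul,
    show matUndo F * matVac F = 0 by ext o c; simp [Matrix.mul_apply, matUndo, matVac],
    map_zero, LinearMap.zero_apply]

theorem loc_matUndo_loc_matDiff {s : Fin n} {w : FaceModule F n}
    (hw : loc F s (matVac F) w = w) : loc F s (matUndo F) (loc F s (matDiff F) w) = w := by
  rw [loc_loc_of_vac hw (Y := 1), map_one, Module.End.one_apply]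
  ext o c
  rcases o with _ | _ | _ <;> rcases c with _ | _ | _ <;>
    simp [Matrix.mul_apply, Fintype.sum_option, matUndo, matDiff, matVac]

theorem loc_matUndo_loc_matEps {s : Fin n} {w : FaceModule F n}
    (hw : loc F s (matVac F) w = w) : loc F s (matUndo F) (loc F s (matEps F) w) = w := by
  rw [loc_loc_of_vac hw (Y := 1), map_one, Module.End.one_apply]
  ext o c
  rcases o with _ | _ | _ <;> rcases c with _ | _ | _ <;>
    simp [Matrix.mul_apply, Fintype.sum_option, matUndo, matEps, matVac]

/-- The vector is `∏_{s ∈ S} (α_s - ᾱ_s)`: on each factor `∂` is `0` and `σ` is `-1`. -/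
theorem exists_primitive_zero (j : ℕ) (hj : j ≤ n) :
    ∃ (S : Finset (Fin n)) (w : FaceModule F n), S.card = j ∧ w ≠ 0 ∧
      (∀ s ∉ S, loc F s (matVac F) w = w) ∧ delMap F n w = 0 ∧
      tot F n (matNum F) w = (j : F) • w ∧ sigmaMap F n w = (-(j : F)) • w := by
  induction j with
  | zero =>
    have hc : ∀ s, (signedFace (∅ : Finset (Fin n)) ∅).coord s = none := fun s => by
      simp [coord_signedFace]
    have h0 : (signedFace (∅ : Finset (Fin n)) ∅).size = 0 := size_signedFace _ _
    refine ⟨∅, Finsupp.single (signedFace ∅ ∅) 1, rfl, by simp, fun s _ => ?_, ?_, ?_, ?_⟩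
    · rw [loc_single, hc]
      conv_rhs => rw [← Face.setCoord_coord (signedFace ∅ ∅) s, hc]
      simp [matVac]
    · exact delMap_eq_zero (h0 ▸ single_mem_faceSub _ _)
    · rw [tot_matNum_single, h0]
    · rw [sigmaMap_signedFace]
      simp
  | succ j ih =>
    obtain ⟨S, w, hS, hw, hvac, hd, hN, hs⟩ := ih (by omega)
    obtain ⟨s, hsS⟩ : ∃ s, s ∉ S := by
      by_contra! h
      have := Finset.card_le_card (fun i _ => h i : (Finset.univ : Finset (Fin n)) ⊆ S)
      simp only [Finset.card_univ, Fintype.card_fin] at this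
      omega
    have hv := hvac s hsS
    refine ⟨insert s S, loc F s (matDiff F) w, by rw [Finset.card_insert_of_notMem hsS, hS],
      fun h => hw ?_, fun t ht => ?_, ?_, ?_, ?_⟩
    · rw [← loc_matUndo_loc_matDiff hv, h, map_zero]
    · rw [Finset.mem_insert, not_or] at ht
      rw [loc_comm_apply ht.1, hvac t ht.2]
    · rw [delMap_loc_matDiff hv, hd, map_zero]
    · rw [tot_matNum_loc_matDiff hv, hN, map_smul]
      push_cast
      module
    · rw [sigmaMap_loc_matDiff hv, hs, map_smul]
      push_cast
      module

/-- Multiply by `i` factors `(α_s + ᾱ_s) - (α_t + ᾱ_t)` on disjoint pairs of fresh indices. On each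
factor `∂` gives `2 - 2 = 0`, while `σ` is `1`; the index set grows by two and the degree by one. -/
theorem exists_primitive (i j : ℕ) (hij : j + 2 * i ≤ n) :
    ∃ (S : Finset (Fin n)) (w : FaceModule F n), S.card = j + 2 * i ∧ w ≠ 0 ∧
      (∀ s ∉ S, loc F s (matVac F) w = w) ∧ delMap F n w = 0 ∧
      tot F n (matNum F) w = ((j + i : ℕ) : F) • w ∧
      sigmaMap F n w = ((i : F) - j) • w := by
  induction i with
  | zero => simpa using exists_primitive_zero (F := F) (n := n) j (by omega)
  | succ i ih =>
    obtain ⟨S, w, hS, hw, hvac, hd, hN, hs⟩ := ih (by omega)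
    obtain ⟨T, hST, hT⟩ := Finset.exists_superset_card_eq (s := S) (n := j + 2 * (i + 1))
      (by omega) (by simpa using hij)
    obtain ⟨s, t, hst, hTS⟩ := Finset.card_eq_two.1
      (show (T \ S).card = 2 by rw [Finset.card_sdiff_of_subset hST]; omega)
    have hsS : s ∉ S := (Finset.mem_sdiff.1 (hTS ▸ by simp : s ∈ T \ S)).2
    have htS : t ∉ S := (Finset.mem_sdiff.1 (hTS ▸ by simp : t ∈ T \ S)).2
    have hvs := hvac s hsS
    have hvt := hvac t htS
    refine ⟨T, loc F s (matEps F) w - loc F t (matEps F) w, hT,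
      fun h => hw ?_, fun r hr => ?_, ?_, ?_, ?_⟩
    -- Removing `α_s` returns `w` from the first term and kills the second, which has no vertex at
    -- `s`.
    · have h1 := congrArg (loc F s (matUndo F)) h
      rwa [map_sub, loc_matUndo_loc_matEps hvs, loc_comm_apply hst, loc_matUndo_of_vac hvs,
        map_zero, map_zero, sub_zero] at h1
    · have hrS : r ∉ S := fun h => hr (hST h)
      have hrs : r ≠ s := by
        rintro rfl
        exact hr (Finset.mem_sdiff.1 (hTS ▸ by simp : r ∈ T \ S)).1
      have hrt : r ≠ t := by
        rintro rfl
        exact hr (Finset.mem_sdiff.1 (hTS ▸ by simp : r ∈ T \ S)).1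
      rw [map_sub, loc_comm_apply hrs, loc_comm_apply hrt, hvac r hrS]
    · rw [map_sub, delMap_loc_matEps hvs, delMap_loc_matEps hvt, hd]
      simp
    · rw [map_sub, tot_matNum_loc_matEps hvs, tot_matNum_loc_matEps hvt, hN, map_smul, map_smul]
      push_cast
      module
    · rw [map_sub, sigmaMap_loc_matEps hvs, sigmaMap_loc_matEps hvt, hs, map_smul, map_smul]
      push_cast
      module

theorem specEI_ne_bot (hF : ∀ m : ℕ, 0 < m → m ≤ n → (m : F) ≠ 0) (h2 : (2 : F) ≠ 0)
    {k j i : ℕ} (hj : j + i ≤ k) (hk : k + i ≤ n) : specEI F n k j i ≠ ⊥ := by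
  induction k, hj using Nat.le_induction with
  | base =>
    obtain ⟨S, w, -, hw, -, hd, hN, hs⟩ := exists_primitive (F := F) (n := n) i j (by omega)
    rw [Submodule.ne_bot_iff]
    refine ⟨w, ?_, hw⟩
    have hE : w ∈ specE F n (j + i) j := by
      rw [mem_specE_iff hF h2 (by omega) (by omega)]
      refine ⟨mem_faceSub_of_tot_matNum hF (by omega) hN, ?_⟩
      rw [hs]
      push_cast
      congr 1
      ring
    simpa using mem_specEI_of_delMap_eq_zero (by omega) hE hd
  | succ k hj ih =>
    obtain ⟨f, hf, hf0⟩ := (Submodule.ne_bot_iff _).1 (ih (by omega))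
    rw [Submodule.ne_bot_iff]
    refine ⟨epsMap F n f, epsMap_mem_specEI hF h2 (by omega) hf, fun h => ?_⟩
    have := (mem_specEI_iff.1 hf).2
    rw [nuPlus_apply, h, map_zero] at this
    exact smul_ne_zero (specLam_ne_zero hF h2 (by omega) (by omega)) hf0 this.symm

end Primitive

/-! ### The two eigenspace decompositions -/

section Spectral

variable {F : Type*} [Field F] {n : ℕ}

theorem nuPlus_decomposition (hF : ∀ m : ℕ, 0 < m → m ≤ n → (m : F) ≠ 0) (h2 : (2 : F) ≠ 0)
    {k j : ℕ} (hk : k ≤ n) (hj : j ≤ k) :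
    IsEigenspaceDecomposition (nuPlus F n) (specE F n k j)
      (fun i : Fin (min (k - j) (n - k) + 1) => specLam F n k j i)
      (fun i : Fin (min (k - j) (n - k) + 1) => specEI F n k j i) := by
  refine isEigenspaceDecomposition_of_iSup_eq ?_ (fun i => inf_le_right)
    (fun i => specEI_ne_bot hF h2 (by omega) (by omega)) (iSup_specEI hF h2 hk hj)
  intro i i' h
  exact Fin.ext (specLam_injective hF h2 hk hj (by omega) (by omega) h)

theorem sigmaMap_decomposition (hF : ∀ m : ℕ, 0 < m → m ≤ n → (m : F) ≠ 0) (h2 : (2 : F) ≠ 0)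
    {k : ℕ} (hk : k ≤ n) :
    IsEigenspaceDecomposition (sigmaMap F n) (faceSub F n k)
      (fun j : Fin (k + 1) => (k : F) - 2 * ((j : ℕ) : F))
      (fun j : Fin (k + 1) => specE F n k j) := by
  refine isEigenspaceDecomposition_of_iSup_eq (sigma_eigenvalue_injective hF h2 hk _)
    (fun j => specE_le_eigenspace k j) (fun j h => ?_) (iSup_specE h2 le_rfl)
  -- `E_{k,j}` contains the nonzero component `E_{k,j,0}`.
  exact specEI_ne_bot hF h2 (k := k) (j := j) (i := 0) (by omega) (by omega)
    (le_bot_iff.1 ((specEI_le_specE _ _ _).trans h.le))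

end Spectral

/-! ### Orbits on pairs of faces and the dimension of the commutant -/

section Equivariance

variable {F : Type*} [Field F] {n : ℕ}

theorem faceRep_single (g : Hyperoct n) (x : Face n) (c : F) :
    faceRep F n g (Finsupp.single x c) = Finsupp.single (g • x) c :=
  Finsupp.mapDomain_single

theorem faceRep_apply_smul (g : Hyperoct n) (f : FaceModule F n) (x : Face n) :
    faceRep F n g f (g • x) = f x :=
  Finsupp.mapDomain_apply (MulAction.injective g) f x

theorem mem_smul_face (g : Hyperoct n) (x : Face n) (v : Vertex n) :
    g.1 v ∈ (g • x).1 ↔ v ∈ x.1 :=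
  Finset.mem_map' g.1.toEmbedding

theorem size_smul (g : Hyperoct n) (x : Face n) : (g • x).size = x.size :=
  Finset.card_map _

theorem smul_subset_smul_face (g : Hyperoct n) (x y : Face n) :
    (g • x).1 ⊆ (g • y).1 ↔ x.1 ⊆ y.1 :=
  Finset.map_subset_map

theorem commute_of_single {T : Module.End F (FaceModule F n)} {g : Hyperoct n}
    (h : ∀ x : Face n, faceRep F n g (T (Finsupp.single x 1)) = T (Finsupp.single (g • x) 1)) :
    faceRep F n g * T = T * faceRep F n g := by
  refine Finsupp.lhom_ext' fun x => LinearMap.ext_ring ?_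
  simp only [LinearMap.comp_apply, Finsupp.lsingle_apply, Module.End.mul_apply, faceRep_single, h]

theorem faceRep_mul_epsMap (g : Hyperoct n) :
    faceRep F n g * epsMap F n = epsMap F n * faceRep F n g := by
  refine commute_of_single fun x => ?_
  rw [epsMap_single, epsMap_single, map_sum]
  refine Finset.sum_equiv (MulAction.toPerm g) (fun y => ?_) fun y _ => faceRep_single g y 1
  simp only [Finset.mem_filter, Finset.mem_univ, true_and, MulAction.toPerm_apply, size_smul,
    smul_subset_smul_face]

theorem faceRep_mul_delMap (g : Hyperoct n) :
    faceRep F n g * delMap F n = delMap F n * faceRep F n g := by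
  refine commute_of_single fun x => ?_
  rw [delMap_single, delMap_single, map_sum]
  refine Finset.sum_equiv (MulAction.toPerm g) (fun y => ?_) fun y _ => faceRep_single g y 1
  simp only [Finset.mem_filter, Finset.mem_univ, true_and, MulAction.toPerm_apply, size_smul,
    smul_subset_smul_face]

theorem faceRep_mul_idAt (g : Hyperoct n) (k : ℕ) :
    faceRep F n g * idAt F n k = idAt F n k * faceRep F n g := by
  refine commute_of_single fun x => ?_
  rw [idAt_single, idAt_single, size_smul]
  split_ifs
  · exact faceRep_single g x 1
  · exact map_zero _

theorem coord_smul_eq {x x' : Face n} {g : Hyperoct n} {e : Equiv.Perm (Fin n)} {s : Fin n → Bool}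
    (hg : ∀ v, g.1 v = (e v.1, xor (s v.1) v.2))
    (h : ∀ i, x'.coord (e i) = (x.coord i).map (xor (s i))) : g • x = x' := by
  apply Subtype.ext
  ext w
  obtain ⟨v, rfl⟩ := g.1.surjective w
  rw [mem_smul_face, Face.mem_iff_coord, Face.mem_iff_coord, hg, h]
  rcases x.coord v.1 with _ | b
  · simp
  · simp

/-- The signed permutation with given underlying permutation and signs. -/
def signedPerm (e : Equiv.Perm (Fin n)) (s : Fin n → Bool) : Hyperoct n :=
  ⟨{ toFun := fun v => (e v.1, xor (s v.1) v.2)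
     invFun := fun v => (e.symm v.1, xor (s (e.symm v.1)) v.2)
     left_inv := fun v => by simp
     right_inv := fun v => by simp }, fun v => by simp [opp]⟩

/-- The relative position of two faces at an index. -/
def pairType (x y : Face n) (i : Fin n) : Fin 5 :=
  if x.coord i = none then (if y.coord i = none then 0 else 2)
  else if y.coord i = none then 1 else if x.coord i = y.coord i then 3 else 4

/-- The number of indices at which two faces have a given relative position. -/
def pairCount (x y : Face n) (c : Fin 5) : ℕ :=
  (Finset.univ.filter fun i => pairType x y i = c).card

/-- Equal counts allow a permutation of the indices that preserves relative positions; a sign at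
each index then adjusts both faces. -/
theorem exists_smul_eq_of_pairCount {x y x' y' : Face n}
    (h : ∀ c, pairCount x y c = pairCount x' y' c) :
    ∃ g : Hyperoct n, g • x = x' ∧ g • y = y' := by
  have hc : ∀ c, Fintype.card {i // pairType x y i = c} =
      Fintype.card {i // pairType x' y' i = c} := fun c => by
    rw [Fintype.card_subtype, Fintype.card_subtype]
    exact h c
  set e : Equiv.Perm (Fin n) := Equiv.ofFiberEquiv fun c => Fintype.equivOfCardEq (hc c) with he
  have het : ∀ i, pairType x' y' (e i) = pairType x y i := fun i => Equiv.ofFiberEquiv_map _ i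
  -- One sign serves both faces because agreement and opposition are preserved by a common flip;
  -- this is a finite check on four letters.
  have hs : ∀ i, ∃ b : Bool, x'.coord (e i) = (x.coord i).map (xor b) ∧
      y'.coord (e i) = (y.coord i).map (xor b) := by
    intro i
    have := het i
    unfold pairType at this
    revert this
    generalize x'.coord (e i) = a1
    generalize y'.coord (e i) = a2
    generalize x.coord i = a3
    generalize y.coord i = a4
    revert a1 a2 a3 a4
    decide
  choose s hs1 hs2 using hs
  exact ⟨signedPerm e s, coord_smul_eq (fun _ => rfl) hs1, coord_smul_eq (fun _ => rfl) hs2⟩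

theorem size_left_eq_pairCount (x y : Face n) :
    x.size = pairCount x y 1 + pairCount x y 3 + pairCount x y 4 := by
  simp only [Face.size_eq_sum, pairCount, Finset.card_filter, ← Finset.sum_add_distrib]
  refine Finset.sum_congr rfl fun i _ => ?_
  unfold pairType
  generalize x.coord i = a1
  generalize y.coord i = a2
  revert a1 a2
  decide

theorem size_right_eq_pairCount (x y : Face n) :
    y.size = pairCount x y 2 + pairCount x y 3 + pairCount x y 4 := by
  simp only [Face.size_eq_sum, pairCount, Finset.card_filter, ← Finset.sum_add_distrib]
  refine Finset.sum_congr rfl fun i _ => ?_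
  unfold pairType
  generalize x.coord i = a1
  generalize y.coord i = a2
  revert a1 a2
  decide

theorem sum_pairCount (x y : Face n) : ∑ c, pairCount x y c = n := by
  have := Finset.card_eq_sum_card_fiberwise (f := pairType x y) (s := Finset.univ)
    (t := Finset.univ) (fun _ _ => Finset.mem_univ _)
  simpa [pairCount] using this.symm

/-- The index set of the components `E_{k,j,i}`, as triples `(k, j, i)`. -/
abbrev CompIndex (n : ℕ) : Type :=
  {p : Fin (n + 1) × Fin (n + 1) × Fin (n + 1) //
    (p.2.1 : ℕ) + p.2.2 ≤ p.1 ∧ (p.1 : ℕ) + p.2.2 ≤ n}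

/-- The pairs of components with the same `j` and `i`. -/
abbrev linkedPairs (n : ℕ) : Finset (CompIndex n × CompIndex n) :=
  Finset.univ.filter fun q => q.1.1.2 = q.2.1.2

/-- The pair of components that corresponds to the orbit of a pair of faces. -/
def orbitIndex (x y : Face n) : CompIndex n × CompIndex n :=
  have h1 := size_left_eq_pairCount x y
  have h2 := size_right_eq_pairCount x y
  have h3 : pairCount x y 0 + pairCount x y 1 + pairCount x y 2 + pairCount x y 3 +
      pairCount x y 4 = n := by
    have := sum_pairCount x y
    rwa [Fin.sum_univ_five] at this
  -- Removing the common indices from the smaller face leaves `min(c₁, c₂)`, the smaller of the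
  -- counts of indices used by just one face. This is the `i` of the orbit; its `j` is the number of
  -- opposite vertices.
  have h4 : min x.size y.size - pairCount x y 3 - pairCount x y 4 < n + 1 := by omega
  have h5 : pairCount x y 4 < n + 1 := by omega
  (⟨(⟨x.size, by omega⟩, ⟨pairCount x y 4, h5⟩,
      ⟨min x.size y.size - pairCount x y 3 - pairCount x y 4, h4⟩), by
      constructor <;> dsimp only <;> omega⟩,
    ⟨(⟨y.size, by omega⟩, ⟨pairCount x y 4, h5⟩,
      ⟨min x.size y.size - pairCount x y 3 - pairCount x y 4, h4⟩), by
      constructor <;> dsimp only <;> omega⟩)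

theorem orbitIndex_mem (x y : Face n) : orbitIndex x y ∈ linkedPairs n := by
  simp [orbitIndex]

/-- The label determines all five counts: `c₄ = j`, while `c₁ - c₂` is the difference of the sizes
and `min(c₁, c₂) = i`; then `c₃` follows from a size and `c₀` from the total `n`. -/
theorem exists_smul_eq_of_orbitIndex {x y x' y' : Face n} (h : orbitIndex x y = orbitIndex x' y') :
    ∃ g : Hyperoct n, g • x = x' ∧ g • y = y' := by
  simp only [orbitIndex, Prod.mk.injEq, Subtype.mk.injEq, Fin.mk.injEq] at h
  obtain ⟨⟨hx, hj, hi⟩, hy, -, -⟩ := h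
  have h1 := size_left_eq_pairCount x y
  have h2 := size_right_eq_pairCount x y
  have h3 := sum_pairCount x y
  have h1' := size_left_eq_pairCount x' y'
  have h2' := size_right_eq_pairCount x' y'
  have h3' := sum_pairCount x' y'
  rw [Fin.sum_univ_five] at h3 h3'
  refine exists_smul_eq_of_pairCount fun c => ?_
  fin_cases c <;> dsimp only [Fin.zero_eta, Fin.mk_one, Fin.reduceFinMk] <;> omega

/-- The algebra of endomorphisms of `M^n` that commute with `B_n`. -/
noncomputable abbrev equivariantEnd (F : Type*) [Field F] (n : ℕ) :
    Subalgebra F (Module.End F (FaceModule F n)) :=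
  Subalgebra.centralizer F (Set.range (faceRep F n))

theorem mem_equivariantEnd {T : Module.End F (FaceModule F n)} :
    T ∈ equivariantEnd F n ↔ ∀ g, faceRep F n g * T = T * faceRep F n g := by
  rw [equivariantEnd, Subalgebra.mem_centralizer_iff]
  exact Set.forall_mem_range

theorem finrank_le_card_of_factorsThrough {K X Q : Type*} [Field K] [Fintype Q]
    (q : X → Q) (W : Submodule K (X → K)) (h : ∀ t ∈ W, Function.FactorsThrough t q) :
    Module.finrank K W ≤ Fintype.card Q := by
  have hle : W ≤ LinearMap.range (LinearMap.funLeft K K q) := by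
    intro t ht
    exact ⟨Function.extend q t 0, funext fun x => (h t ht).extend_apply 0 x⟩
  calc Module.finrank K W ≤ Module.finrank K (LinearMap.range (LinearMap.funLeft K K q)) :=
        Submodule.finrank_mono hle
    _ ≤ Module.finrank K (Q → K) := LinearMap.finrank_range_le _
    _ = Fintype.card Q := Module.finrank_fintype_fun_eq_card K

/-- The matrix of an equivariant endomorphism is constant on orbits of pairs of faces, hence factors
through `orbitIndex`. -/
theorem finrank_equivariantEnd_le :
    Module.finrank F (equivariantEnd F n) ≤ (linkedPairs n).card := by
  let Φ : Module.End F (FaceModule F n) →ₗ[F] (Face n × Face n → F) :=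
    { toFun := fun T p => T (Finsupp.single p.1 1) p.2
      map_add' := fun _ _ => rfl
      map_smul' := fun _ _ => rfl }
  have hΦ : Function.Injective Φ := by
    intro T T' h
    refine Finsupp.lhom_ext' fun x => LinearMap.ext_ring ?_
    ext y
    exact congrFun h (x, y)
  let A := Subalgebra.toSubmodule (equivariantEnd F n)
  have h1 : Module.finrank F (A.map Φ) = Module.finrank F A :=
    (Submodule.equivMapOfInjective Φ hΦ A).finrank_eq.symm
  have h2 := finrank_le_card_of_factorsThrough (K := F)
    (fun p : Face n × Face n => (⟨orbitIndex p.1 p.2, orbitIndex_mem _ _⟩ : linkedPairs n))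
    (A.map Φ) (by
      rintro _ ⟨T, hT, rfl⟩ ⟨x, y⟩ ⟨x', y'⟩ h
      obtain ⟨g, rfl, rfl⟩ := exists_smul_eq_of_orbitIndex (Subtype.ext_iff.1 h)
      have := LinearMap.congr_fun (mem_equivariantEnd.1 hT g) (Finsupp.single x 1)
      rw [Module.End.mul_apply, Module.End.mul_apply, faceRep_single] at this
      change T (Finsupp.single x 1) y = T (Finsupp.single (g • x) 1) (g • y)
      rw [← this, faceRep_apply_smul])
  rw [h1, Fintype.card_coe] at h2
  exact h2

end Equivariance

/-! ### A dimension criterion for the commutant -/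

section MultiplicityOne

variable {F V : Type*} [Field F] [AddCommGroup V] [Module F V]

/-- A Lagrange interpolation polynomial in `T` is `1` at `lam s` and `0` at the other values, and it
stays in any subalgebra containing `T`. -/
theorem exists_eigenprojection {ι : Type*} [Fintype ι] [DecidableEq ι]
    (S : Subalgebra F (Module.End F V)) {T : Module.End F V} (hT : T ∈ S) {lam : ι → F}
    (hlam : Function.Injective lam) (s : ι) :
    ∃ e ∈ S, ∀ t v, T v = lam t • v → e v = if t = s then v else 0 := by
  refine ⟨Polynomial.aeval T (Lagrange.basis Finset.univ lam s),
    
    Algebra.adjoin_le (Set.singleton_subset_iff.2 hT)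
      (Polynomial.aeval_mem_adjoin_singleton F T), fun t v hv => ?_⟩
  rw [Module.End.aeval_apply_of_mem_apply_eq_smul hv]
  split_ifs with h
  · rw [h, Lagrange.eval_basis_self hlam.injOn (Finset.mem_univ s), one_smul]
  · rw [Lagrange.eval_basis_of_ne (Ne.symm h) (Finset.mem_univ t), zero_smul]

/-- If the operators `R p q π_p`, for `(p, q) ∈ Q`, lie in a subalgebra `S` of an algebra `A` of
dimension at most `|Q|`, then they form a basis of `A`. -/
theorem eq_and_scalar_of_finrank_le [FiniteDimensional F V] {I : Type*} [DecidableEq I]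
    {S A : Subalgebra F (Module.End F V)} (hSA : S ≤ A) (E : I → Submodule F V)
    (hE : ∀ p, E p ≠ ⊥) (π : I → Module.End F V) (hπS : ∀ p, π p ∈ S)
    (hπ : ∀ p q, ∀ v ∈ E q, π p v = if q = p then v else 0) (Q : Finset (I × I))
    (R : I → I → Module.End F V) (hRS : ∀ p q, (p, q) ∈ Q → R p q ∈ S)
    (hR : ∀ p q, (p, q) ∈ Q → ∀ v ∈ E p, R p q v ∈ E q ∧ (v ≠ 0 → R p q v ≠ 0))
    (hfin : Module.finrank F A ≤ Q.card) :
    S = A ∧ ∀ T ∈ A, ∀ p q, ∃ c : F, ∀ v ∈ E p,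
      π q (T v) = c • if (p, q) ∈ Q then R p q v else 0 := by
  let P : Q → Module.End F V := fun x => R x.1.1 x.1.2 * π x.1.1
  -- The operators `P` behave like matrix units, each seen by exactly one pair of source and target.
  -- This yields independence and reads off coefficients.
  have hP : ∀ p q, ∀ v ∈ E p, ∀ x : Q,
      π q (P x v) = if x.1 = (p, q) then R p q v else 0 := by
    rintro p q v hv ⟨⟨p', q'⟩, hx⟩
    simp only [P, Module.End.mul_apply, hπ p' p v hv, Prod.mk.injEq]
    by_cases hp : p = p'
    · subst hp
      rw [if_pos rfl, hπ q q' _ (hR p q' hx v hv).1]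
      by_cases hq : q' = q
      · subst hq; simp
      · simp [hq]
    · rw [if_neg hp, map_zero, map_zero, if_neg fun h => hp h.1.symm]
  have hsum : ∀ (c : Q → F) (p q : I), ∀ v ∈ E p, π q ((∑ x, c x • P x) v) =
      if h : (p, q) ∈ Q then c ⟨(p, q), h⟩ • R p q v else 0 := by
    intro c p q v hv
    simp only [LinearMap.sum_apply, LinearMap.smul_apply, map_sum, map_smul, hP p q v hv,
      smul_ite, smul_zero]
    split_ifs with h
    · rw [Finset.sum_eq_single ⟨(p, q), h⟩]
      · simp
      · intro x _ hx
        exact if_neg fun h' => hx (Subtype.ext h')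
      · simp
    · refine Finset.sum_eq_zero fun x _ => if_neg ?_
      rintro h'
      exact h (h' ▸ x.2)
  have hlin : LinearIndependent F P := by
    rw [Fintype.linearIndependent_iff]
    rintro c hc ⟨⟨p, q⟩, hx⟩
    obtain ⟨v, hv, hv0⟩ := (Submodule.ne_bot_iff _).1 (hE p)
    have := hsum c p q v hv
    rw [hc, dif_pos hx, LinearMap.zero_apply, map_zero] at this
    exact (smul_eq_zero.1 this.symm).resolve_right ((hR p q hx v hv).2 hv0)
  have hPS : Submodule.span F (Set.range P) ≤ Subalgebra.toSubmodule S := by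
    rw [Submodule.span_le]
    rintro _ ⟨x, rfl⟩
    exact S.mul_mem (hRS _ _ x.2) (hπS _)
  have hspan : Submodule.span F (Set.range P) = Subalgebra.toSubmodule A := by
    refine Submodule.eq_of_le_of_finrank_le (hPS.trans hSA) ?_
    rw [finrank_span_eq_card hlin, Fintype.card_coe]
    exact hfin
  refine ⟨le_antisymm hSA ?_, fun T hT p q => ?_⟩
  · rw [← Subalgebra.toSubmodule.le_iff_le]
    exact hspan.symm.le.trans hPS
  · have hT' : T ∈ Submodule.span F (Set.range P) := by
      rw [hspan]; exact hT
    obtain ⟨c, rfl⟩ := (Submodule.mem_span_range_iff_exists_fun F).1 hT'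
    by_cases h : (p, q) ∈ Q
    · refine ⟨c ⟨(p, q), h⟩, fun v hv => ?_⟩
      rw [hsum c p q v hv, dif_pos h, if_pos h]
    · refine ⟨0, fun v hv => ?_⟩
      rw [hsum c p q v hv, dif_neg h, zero_smul]

end MultiplicityOne

/-! ### The incidence algebra and its action on components -/

section Components

variable {F : Type*} [Field F] {n : ℕ}

/-- The algebra generated by the `ε_k`, `∂_k` and `id_{M_k}`. -/
noncomputable abbrev incidenceAlgebra (F : Type*) [Field F] (n : ℕ) :
    Subalgebra F (Module.End F (FaceModule F n)) :=
  Algebra.adjoin F {T : Module.End F (FaceModule F n) |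
    ∃ k ≤ n, T = epsAt F n k ∨ T = delAt F n k ∨ T = idAt F n k}

theorem idAt_mem_incidenceAlgebra {k : ℕ} (hk : k ≤ n) : idAt F n k ∈ incidenceAlgebra F n :=
  Algebra.subset_adjoin ⟨k, hk, Or.inr (Or.inr rfl)⟩

theorem epsMap_mem_incidenceAlgebra : epsMap F n ∈ incidenceAlgebra F n := by
  have h : epsMap F n = ∑ k ∈ Finset.range (n + 1), epsAt F n k := by
    change _ = ∑ k ∈ Finset.range (n + 1), epsMap F n * idAt F n k
    rw [← Finset.mul_sum, sum_idAt, mul_one]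
  rw [h]
  exact Subalgebra.sum_mem _ fun k hk =>
    Algebra.subset_adjoin ⟨k, Finset.mem_range_succ_iff.1 hk, Or.inl rfl⟩

theorem delMap_mem_incidenceAlgebra : delMap F n ∈ incidenceAlgebra F n := by
  have h : delMap F n = ∑ k ∈ Finset.range (n + 1), delAt F n k := by
    change _ = ∑ k ∈ Finset.range (n + 1), delMap F n * idAt F n k
    rw [← Finset.mul_sum, sum_idAt, mul_one]
  rw [h]
  exact Subalgebra.sum_mem _ fun k hk =>
    Algebra.subset_adjoin ⟨k, Finset.mem_range_succ_iff.1 hk, Or.inr (Or.inl rfl)⟩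

theorem nuPlus_mem_incidenceAlgebra : nuPlus F n ∈ incidenceAlgebra F n :=
  Subalgebra.mul_mem _ delMap_mem_incidenceAlgebra epsMap_mem_incidenceAlgebra

theorem tot_matNum_eq_sum :
    tot F n (matNum F) = ∑ k ∈ Finset.range (n + 1), (k : F) • idAt F n k := by
  refine LinearMap.ext fun f => ?_
  ext x
  rw [tot_matNum_apply, LinearMap.sum_apply, Finsupp.finsetSum_apply]
  simp only [LinearMap.smul_apply, Finsupp.smul_apply, idAt_apply, smul_eq_mul, mul_ite,
    mul_zero, Finset.sum_ite_eq, Finset.mem_range]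
  rw [if_pos (Nat.lt_succ_of_le x.size_le)]

/-- Solving the relation for `[∂, ε]` shows that `σ`, though not a generator, lies in the incidence
algebra. -/
theorem sigmaMap_eq_of_commutator : sigmaMap F n = (2 * n : F) • 1 +
    (-3 : F) • tot F n (matNum F) + (-1 : F) • (delMap F n * epsMap F n) +
      epsMap F n * delMap F n := by
  refine LinearMap.ext fun f => ?_
  have := LinearMap.congr_fun (delMap_mul_epsMap (F := F) (n := n)) f
  simp only [LinearMap.add_apply, LinearMap.sub_apply, LinearMap.smul_apply] at this ⊢
  rw [this]
  module

theorem tot_matNum_mem_incidenceAlgebra : tot F n (matNum F) ∈ incidenceAlgebra F n := by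
  rw [tot_matNum_eq_sum]
  exact Subalgebra.sum_mem _ fun k hk => Subalgebra.smul_mem _
    (idAt_mem_incidenceAlgebra (Finset.mem_range_succ_iff.1 hk)) _

theorem sigmaMap_mem_incidenceAlgebra : sigmaMap F n ∈ incidenceAlgebra F n := by
  have h1 := Subalgebra.mul_mem _ (delMap_mem_incidenceAlgebra (F := F) (n := n))
    epsMap_mem_incidenceAlgebra
  have h2 := Subalgebra.mul_mem _ (epsMap_mem_incidenceAlgebra (F := F) (n := n))
    delMap_mem_incidenceAlgebra
  rw [sigmaMap_eq_of_commutator]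
  exact Subalgebra.add_mem _ (Subalgebra.add_mem _ (Subalgebra.add_mem _
    (Subalgebra.smul_mem _ (Subalgebra.one_mem _) _)
    (Subalgebra.smul_mem _ tot_matNum_mem_incidenceAlgebra _)) (Subalgebra.smul_mem _ h1 _)) h2

theorem incidenceAlgebra_le : incidenceAlgebra F n ≤ equivariantEnd F n := by
  refine Algebra.adjoin_le ?_
  have hid : ∀ k, idAt F n k ∈ equivariantEnd F n := fun k =>
    mem_equivariantEnd.2 fun g => faceRep_mul_idAt g k
  rintro T ⟨k, -, rfl | rfl | rfl⟩
  · exact Subalgebra.mul_mem _ (mem_equivariantEnd.2 faceRep_mul_epsMap) (hid k)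
  · exact Subalgebra.mul_mem _ (mem_equivariantEnd.2 faceRep_mul_delMap) (hid k)
  · exact hid k

theorem apply_faceRep {T : Module.End F (FaceModule F n)} (hT : T ∈ equivariantEnd F n)
    (g : Hyperoct n) (f : FaceModule F n) : T (faceRep F n g f) = faceRep F n g (T f) :=
  (LinearMap.congr_fun (mem_equivariantEnd.1 hT g) f).symm

theorem faceRep_mem_faceSub (k : ℕ) (g : Hyperoct n) {f : FaceModule F n}
    (hf : f ∈ faceSub F n k) : faceRep F n g f ∈ faceSub F n k := by
  have h : idAt F n k (faceRep F n g f) = faceRep F n g f := by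
    rw [apply_faceRep (mem_equivariantEnd.2 fun g => faceRep_mul_idAt g k), idAt_of_mem hf]
  rw [← h]
  exact idAt_mem k _

theorem faceRep_mem_specE (hF : ∀ m : ℕ, 0 < m → m ≤ n → (m : F) ≠ 0) (h2 : (2 : F) ≠ 0)
    (k j : ℕ) (g : Hyperoct n) {f : FaceModule F n} (hf : f ∈ specE F n k j) :
    faceRep F n g f ∈ specE F n k j := by
  by_cases h : k < j ∨ n < k
  · rw [specE_eq_bot h, Submodule.mem_bot] at hf ⊢
    rw [hf, map_zero]
  · rw [mem_specE_iff hF h2 (by omega) (by omega)] at hf ⊢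
    refine ⟨faceRep_mem_faceSub k g hf.1, ?_⟩
    rw [apply_faceRep (incidenceAlgebra_le sigmaMap_mem_incidenceAlgebra), hf.2, map_smul]

theorem faceRep_mem_specEI (hF : ∀ m : ℕ, 0 < m → m ≤ n → (m : F) ≠ 0) (h2 : (2 : F) ≠ 0)
    (k j i : ℕ) (g : Hyperoct n) {f : FaceModule F n} (hf : f ∈ specEI F n k j i) :
    faceRep F n g f ∈ specEI F n k j i := by
  rw [mem_specEI_iff] at hf ⊢
  refine ⟨faceRep_mem_specE hF h2 k j g hf.1, ?_⟩
  rw [apply_faceRep (incidenceAlgebra_le nuPlus_mem_incidenceAlgebra), hf.2, map_smul]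

/-- The component `E_{k,j,i}` with index `(k, j, i)`. -/
noncomputable def component (F : Type*) [Field F] {n : ℕ} (p : CompIndex n) :
    Submodule F (FaceModule F n) :=
  specEI F n p.1.1 p.1.2.1 p.1.2.2

theorem exists_component_projection (hF : ∀ m : ℕ, 0 < m → m ≤ n → (m : F) ≠ 0)
    (h2 : (2 : F) ≠ 0) (p : CompIndex n) :
    ∃ e ∈ incidenceAlgebra F n, ∀ q, ∀ v ∈ component F q, e v = if q = p then v else 0 := by
  obtain ⟨⟨k, j, i⟩, hp⟩ := p
  dsimp only at hp
  obtain ⟨e1, he1, h1⟩ := exists_eigenprojection (incidenceAlgebra F n)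
    sigmaMap_mem_incidenceAlgebra (sigma_eigenvalue_injective hF h2 le_rfl (k : F)) j
  have hinj : Function.Injective fun t : Fin (min ((k : ℕ) - j) (n - k) + 1) =>
      specLam F n k j t := fun t t' h => Fin.ext
    (specLam_injective hF h2 (by omega) (by omega) (by omega) (by omega) h)
  obtain ⟨e2, he2, h3⟩ := exists_eigenprojection (incidenceAlgebra F n)
    nuPlus_mem_incidenceAlgebra hinj ⟨i, by omega⟩
  -- `id_k` selects the level, then a polynomial in `σ` selects `j`, then one in `ν⁺` selects `i`.
  -- The last need only separate eigenvalues on this `E_{k,j}`.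
  refine ⟨e2 * e1 * idAt F n k, Subalgebra.mul_mem _ (Subalgebra.mul_mem _ he2 he1)
    (idAt_mem_incidenceAlgebra (by omega)), ?_⟩
  rintro ⟨⟨k', j', i'⟩, hq⟩ v hv
  dsimp only at hq
  change v ∈ specEI F n k' j' i' at hv
  rw [mem_specEI_iff] at hv
  rw [Module.End.mul_apply, Module.End.mul_apply]
  by_cases hk : k' = k
  · subst hk
    rw [idAt_of_mem (specE_le_faceSub _ _ hv.1),
      h1 j' v (Module.End.mem_eigenspace_iff.1 (specE_le_eigenspace _ _ hv.1))]
    by_cases hj : j' = j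
    · subst hj
      rw [if_pos rfl, h3 ⟨i', by omega⟩ v hv.2]
      refine if_congr ?_ rfl rfl
      simp [Fin.ext_iff]
    · rw [if_neg hj, map_zero, if_neg fun h => hj (by simp at h; exact h.1)]
  · rw [idAt_of_mem_of_ne (fun h => hk (Fin.ext h)) (specE_le_faceSub _ _ hv.1), map_zero,
      map_zero, if_neg fun h => hk (by simp at h; exact h.1)]

theorem epsMap_pow_mem (hF : ∀ m : ℕ, 0 < m → m ≤ n → (m : F) ≠ 0) (h2 : (2 : F) ≠ 0)
    {k j i m : ℕ} (hj : j + i ≤ k) (hk : k + m + i ≤ n) {f : FaceModule F n}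
    (hf : f ∈ specEI F n k j i) :
    (epsMap F n ^ m) f ∈ specEI F n (k + m) j i ∧ (f ≠ 0 → (epsMap F n ^ m) f ≠ 0) := by
  induction m with
  | zero => exact ⟨hf, id⟩
  | succ m ih =>
    obtain ⟨h1, h3⟩ := ih (by omega)
    rw [pow_succ', Module.End.mul_apply]
    refine ⟨epsMap_mem_specEI hF h2 (by omega) h1, fun h0 h => h3 h0 ?_⟩
    have := (mem_specEI_iff.1 h1).2
    rw [nuPlus_apply, h, map_zero] at this
    exact (smul_eq_zero.1 this.symm).resolve_left
      (specLam_ne_zero hF h2 (by omega) (by omega))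

theorem delMap_pow_mem (hF : ∀ m : ℕ, 0 < m → m ≤ n → (m : F) ≠ 0) (h2 : (2 : F) ≠ 0)
    {k j i m : ℕ} (hj : j + i ≤ k) (hk : k + m + i ≤ n) {f : FaceModule F n}
    (hf : f ∈ specEI F n (k + m) j i) :
    (delMap F n ^ m) f ∈ specEI F n k j i ∧ (f ≠ 0 → (delMap F n ^ m) f ≠ 0) := by
  induction m generalizing f with
  | zero => exact ⟨hf, id⟩
  | succ m ih =>
    have h1 := delMap_mem_specEI hF h2 (k := k + m) (by omega) (by omega) hf
    obtain ⟨h3, h4⟩ := ih (by omega) h1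
    rw [pow_succ, Module.End.mul_apply]
    refine ⟨h3, fun h0 => h4 fun h => h0 ?_⟩
    have := epsMap_delMap_of_mem (k := k + m) hf
    rw [h, map_zero] at this
    exact (smul_eq_zero.1 this.symm).resolve_left
      (specLam_ne_zero hF h2 (by omega) (by omega))

/-- The operator from level `k` to level `l` that links components with the same `j` and `i`. -/
noncomputable def link (F : Type*) [Field F] {n : ℕ} (p q : CompIndex n) :
    Module.End F (FaceModule F n) :=
  -- With truncated subtraction at most one exponent is nonzero, so this is a pure power of `ε` or
  -- of `∂`.
  epsMap F n ^ ((q.1.1 : ℕ) - p.1.1) * delMap F n ^ ((p.1.1 : ℕ) - q.1.1)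

theorem link_mem (p q : CompIndex n) : link F p q ∈ incidenceAlgebra F n :=
  Subalgebra.mul_mem _ (Subalgebra.pow_mem _ epsMap_mem_incidenceAlgebra _)
    (Subalgebra.pow_mem _ delMap_mem_incidenceAlgebra _)

theorem link_self (p : CompIndex n) : link F p p = 1 := by
  simp [link]

theorem link_apply_mem (hF : ∀ m : ℕ, 0 < m → m ≤ n → (m : F) ≠ 0) (h2 : (2 : F) ≠ 0)
    {p q : CompIndex n} (h : (p, q) ∈ linkedPairs n) {f : FaceModule F n}
    (hf : f ∈ component F p) :
    link F p q f ∈ component F q ∧ (f ≠ 0 → link F p q f ≠ 0) := by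
  obtain ⟨⟨k, j, i⟩, hp⟩ := p
  obtain ⟨⟨l, j', i'⟩, hq⟩ := q
  simp only [Finset.mem_filter, Finset.mem_univ, true_and, Prod.mk.injEq] at h
  obtain ⟨rfl, rfl⟩ := h
  dsimp only at hp hq
  simp only [link, component] at hf ⊢
  rcases Nat.le_total k l with hkl | hkl
  · rw [show (k : ℕ) - l = 0 by omega, pow_zero, mul_one]
    have := epsMap_pow_mem hF h2 (m := (l : ℕ) - k) hp.1 (by omega) hf
    rwa [show (k : ℕ) + (l - k) = l by omega] at this
  · rw [show (l : ℕ) - k = 0 by omega, pow_zero, one_mul]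
    exact delMap_pow_mem hF h2 (k := l) (m := (k : ℕ) - l) hq.1 (by omega)
      (by rwa [show (l : ℕ) + (k - l) = k by omega])

theorem component_ne_bot (hF : ∀ m : ℕ, 0 < m → m ≤ n → (m : F) ≠ 0) (h2 : (2 : F) ≠ 0)
    (p : CompIndex n) : component F p ≠ ⊥ :=
  specEI_ne_bot hF h2 p.2.1 p.2.2

/-- The incidence algebra is the full algebra of equivariant endomorphisms, and these act by
multiples of the links between components. -/
theorem incidenceAlgebra_eq_and_scalar (hF : ∀ m : ℕ, 0 < m → m ≤ n → (m : F) ≠ 0)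
    (h2 : (2 : F) ≠ 0) :
    incidenceAlgebra F n = equivariantEnd F n ∧
    ∃ π : CompIndex n → Module.End F (FaceModule F n), (∀ p, π p ∈ equivariantEnd F n) ∧
      (∀ p q, ∀ v ∈ component F q, π p v = if q = p then v else 0) ∧
      ∀ T ∈ equivariantEnd F n, ∀ p q, ∃ c : F, ∀ v ∈ component F p,
        π q (T v) = c • if (p, q) ∈ linkedPairs n then link F p q v else 0 := by
  choose π hπS hπ using exists_component_projection (F := F) (n := n) hF h2
  obtain ⟨h1, h3⟩ := eq_and_scalar_of_finrank_le incidenceAlgebra_le (component F)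
    (component_ne_bot hF h2) π hπS hπ (linkedPairs n) (link F) (fun p q _ => link_mem p q)
    (fun p q h v hv => link_apply_mem hF h2 h hv) finrank_equivariantEnd_le
  exact ⟨h1, π, fun p => incidenceAlgebra_le (hπS p), hπ, h3⟩

theorem faceSub_le_iSup_component (hF : ∀ m : ℕ, 0 < m → m ≤ n → (m : F) ≠ 0)
    (h2 : (2 : F) ≠ 0) {k : ℕ} :
    faceSub F n k ≤ ⨆ p : {p : CompIndex n // (p.1.1 : ℕ) = k}, component F p.1 := by
  rcases Nat.lt_or_ge n k with hk | hk
  · rw [faceSub_eq_bot hk]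
    exact bot_le
  refine (faceSub_le_iSup_specE h2 k).trans (iSup_le fun j => ?_)
  rw [← iSup_specEI hF h2 hk (by omega)]
  refine iSup_le fun i => ?_
  exact le_iSup_of_le (⟨⟨(⟨k, by omega⟩, ⟨j, by omega⟩, ⟨i, by omega⟩),
    by constructor <;> dsimp only <;> omega⟩, rfl⟩ : {p : CompIndex n // (p.1.1 : ℕ) = k}) le_rfl

end Components

/-! ### Averaging, and invertibility of the group order -/

section Maschke

variable {F : Type*} [Field F]

theorem exists_equivariant_projection {G V : Type*} [Group G] [Finite G] [AddCommGroup V]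
    [Module F V] (ρ : Representation F G V) (hG : (Nat.card G : F) ≠ 0) (W : Submodule F V)
    (hW : ∀ g, ∀ w ∈ W, ρ g w ∈ W) :
    ∃ T : Module.End F V, (∀ g, ρ g * T = T * ρ g) ∧ (∀ v, T v ∈ W) ∧ ∀ w ∈ W, T w = w := by
  classical
  have := Fintype.ofFinite G
  obtain ⟨r, hr⟩ := W.subtype.exists_leftInverse_of_injective W.ker_subtype
  set P : Module.End F V := W.subtype ∘ₗ r with hP
  have hPm : ∀ v, P v ∈ W := fun v => (r v).2
  have hPw : ∀ w ∈ W, P w = w := fun w hw =>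
    congrArg Subtype.val (LinearMap.congr_fun hr (⟨w, hw⟩ : W))
  refine ⟨(Nat.card G : F)⁻¹ • ∑ g : G, ρ g * P * ρ g⁻¹, fun h => ?_, fun v => ?_, fun w hw => ?_⟩
  · rw [mul_smul_comm, smul_mul_assoc, Finset.mul_sum, Finset.sum_mul]
    congr 1
    refine Fintype.sum_equiv (Equiv.mulLeft h) _ _ fun g => ?_
    simp only [Equiv.coe_mulLeft, map_mul, mul_inv_rev, mul_assoc]
    rw [← map_mul ρ h⁻¹ h, inv_mul_cancel, map_one, mul_one]
  · rw [LinearMap.smul_apply, LinearMap.sum_apply]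
    exact W.smul_mem _ (W.sum_mem fun g _ => hW g _ (hPm _))
  · rw [LinearMap.smul_apply, LinearMap.sum_apply, Finset.sum_congr rfl fun g _ => ?_]
    · rw [Finset.sum_const, Finset.card_univ, ← Nat.card_eq_fintype_card,
        ← Nat.cast_smul_eq_nsmul F, smul_smul, inv_mul_cancel₀ hG, one_smul]
    · rw [Module.End.mul_apply, Module.End.mul_apply, hPw _ (hW _ _ hw), ← Module.End.mul_apply,
        ← map_mul, mul_inv_cancel, map_one, Module.End.one_apply]

/-- Let `g` have prime order `p`. As `p > n`, two of the vertices `g^a v`, `a < p`, share an index,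
so `g^d v` is `v` or its opposite with `0 < d < p`. Then `g^{2d}` fixes `v`, and since `p` does not
divide `2d`, so does `g`; thus `g = 1`, a contradiction. -/
theorem not_prime_dvd_card_hyperoct {n p : ℕ} (hp : p.Prime) (hn : n < p) (hp2 : p ≠ 2) :
    ¬ p ∣ Nat.card (Hyperoct n) := by
  intro hdvd
  have := Fact.mk hp
  obtain ⟨g, hg⟩ := exists_prime_orderOf_dvd_card' p hdvd
  have hgp : g.1 ^ p = 1 := by
    rw [← Subgroup.coe_pow, ← hg, pow_orderOf_eq_one, Subgroup.coe_one]
  refine hp.one_lt.ne' (hg.symm.trans (orderOf_eq_one_iff.2 (Subtype.ext (Equiv.ext fun v => ?_))))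
  change g.1 v = v
  have hper : ∀ m : ℕ, (g.1 ^ m) v = v → p ∣ m ∨ g.1 v = v := by
    intro m hm
    have h1 : Function.IsPeriodicPt g.1 p v := by
      rw [Function.IsPeriodicPt, Equiv.Perm.iterate_eq_pow, hgp]
      rfl
    have h2 : Function.IsPeriodicPt g.1 m v := by
      rw [Function.IsPeriodicPt, Equiv.Perm.iterate_eq_pow]
      exact hm
    rcases (Nat.dvd_prime hp).1 h1.minimalPeriod_dvd with h | h
    · exact Or.inr (Function.minimalPeriod_eq_one_iff_isFixedPt.1 h)
    · exact Or.inl (h ▸ h2.minimalPeriod_dvd)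
  have hopp : ∀ m : ℕ, ∀ w, (g.1 ^ m) (opp w) = opp ((g.1 ^ m) w) := fun m => (g ^ m).2
  obtain ⟨a, b, hab, hidx⟩ := Fintype.exists_ne_map_eq_of_card_lt
    (fun a : Fin p => ((g.1 ^ (a : ℕ)) v).1) (by simpa using hn)
  wlog hlt : a < b generalizing a b
  · exact this b a hab.symm hidx.symm (lt_of_le_of_ne (not_lt.1 hlt) hab.symm)
  have hsplit : (g.1 ^ (b : ℕ)) v = (g.1 ^ (a : ℕ)) ((g.1 ^ ((b : ℕ) - a)) v) := by
    rw [← Equiv.Perm.mul_apply, ← pow_add]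
    congr 2
    omega
  have hcase : (g.1 ^ (b : ℕ)) v = (g.1 ^ (a : ℕ)) v ∨
      (g.1 ^ (b : ℕ)) v = opp ((g.1 ^ (a : ℕ)) v) := by
    revert hidx
    generalize (g.1 ^ (a : ℕ)) v = x
    generalize (g.1 ^ (b : ℕ)) v = y
    obtain ⟨x1, x2⟩ := x
    obtain ⟨y1, y2⟩ := y
    rintro rfl
    cases x2 <;> cases y2 <;> simp [opp]
  have hsmall : ∀ m : ℕ, 0 < m → m < p → ¬ p ∣ m := fun m h0 h1 h =>
    absurd (Nat.le_of_dvd h0 h) (by omega)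
  have hd := hsmall ((b : ℕ) - a) (by omega) (by omega)
  rcases hcase with h | h
  · rw [hsplit] at h
    exact (hper _ ((g.1 ^ (a : ℕ)).injective h)).resolve_left hd
  · rw [hsplit, ← hopp] at h
    have h1 := (g.1 ^ (a : ℕ)).injective h
    refine (hper (2 * ((b : ℕ) - a)) ?_).resolve_left fun h3 => ?_
    · rw [two_mul, pow_add, Equiv.Perm.mul_apply, h1, hopp, h1, opp_opp]
    · rcases hp.dvd_mul.1 h3 with h4 | h4
      · exact hp2 ((Nat.prime_dvd_prime_iff_eq hp Nat.prime_two).1 h4)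
      · exact hd h4

end Maschke

/-! ### Irreducibility, isomorphisms and multiplicity freeness -/

section Irreducibility

variable {F : Type*} [Field F] {n : ℕ}

/-- Every equivariant map from a submodule of `M^n` to `M^n` is induced by an equivariant
endomorphism of `M^n` with the same range. -/
theorem exists_equivariant_extension (hG : (Nat.card (Hyperoct n) : F) ≠ 0) {X : Type*}
    [AddCommMonoid X] [Module F X] (σ : Representation F (Hyperoct n) X)
    (ι φ : X →ₗ[F] FaceModule F n) (hι : Function.Injective ι)
    (hισ : ∀ g x, ι (σ g x) = faceRep F n g (ι x))
    (hφσ : ∀ g x, φ (σ g x) = faceRep F n g (φ x)) :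
    ∃ T ∈ equivariantEnd F n, (∀ x, T (ι x) = φ x) ∧ ∀ v, ∃ x, T v = φ x := by
  obtain ⟨P, hPc, hPm, hPw⟩ := exists_equivariant_projection (faceRep F n) hG
    (LinearMap.range ι) (by
      rintro g _ ⟨x, rfl⟩
      exact ⟨σ g x, hισ g x⟩)
  let r : FaceModule F n →ₗ[F] X :=
    (LinearEquiv.ofInjective ι hι).symm.toLinearMap ∘ₗ P.codRestrict (LinearMap.range ι) hPm
  have hr : ∀ v, ι (r v) = P v := fun v => congrArg Subtype.val
    ((LinearEquiv.ofInjective ι hι).apply_symm_apply (P.codRestrict (LinearMap.range ι) hPm v))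
  refine ⟨φ ∘ₗ r, mem_equivariantEnd.2 fun g => LinearMap.ext fun v => ?_, fun x => ?_,
    fun v => ⟨r v, rfl⟩⟩
  · have h1 : r (faceRep F n g v) = σ g (r v) := by
      apply hι
      rw [hr, hισ, hr]
      exact (LinearMap.congr_fun (hPc g) v).symm
    simp only [Module.End.mul_apply, LinearMap.comp_apply]
    rw [h1, hφσ]
  · have h1 : r (ι x) = x := by
      apply hι
      rw [hr, hPw _ ⟨x, rfl⟩]
    rw [LinearMap.comp_apply, h1]

/-- An equivariant projection onto `W` acts on the component by a scalar `c`. If `c = 0` then `W` is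
zero; otherwise `W` is the whole component. -/
theorem eq_bot_or_eq_component (hF : ∀ m : ℕ, 0 < m → m ≤ n → (m : F) ≠ 0) (h2 : (2 : F) ≠ 0)
    (hG : (Nat.card (Hyperoct n) : F) ≠ 0) (p : CompIndex n) {W : Submodule F (FaceModule F n)}
    (hWp : W ≤ component F p) (hW : ∀ g, ∀ w ∈ W, faceRep F n g w ∈ W) :
    W = ⊥ ∨ W = component F p := by
  obtain ⟨-, π, -, hπ, hscal⟩ := incidenceAlgebra_eq_and_scalar (F := F) (n := n) hF h2
  obtain ⟨T, hT, hTm, hTw⟩ := exists_equivariant_projection (faceRep F n) hG W hW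
  obtain ⟨c, hc⟩ := hscal T (mem_equivariantEnd.2 hT) p p
  have key : ∀ v ∈ component F p, T v = c • v := by
    intro v hv
    have := hc v hv
    rwa [hπ p p _ (hWp (hTm v)), if_pos rfl, if_pos (by simp), link_self] at this
  by_cases h0 : c = 0
  · refine Or.inl ((Submodule.eq_bot_iff W).2 fun w hw => ?_)
    rw [← hTw w hw, key w (hWp hw), h0, zero_smul]
  · refine Or.inr (le_antisymm hWp fun v hv => ?_)
    rw [← Submodule.smul_mem_iff W h0, ← key v hv]
    exact hTm v

theorem component_isIrreducible (hF : ∀ m : ℕ, 0 < m → m ≤ n → (m : F) ≠ 0) (h2 : (2 : F) ≠ 0)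
    (hG : (Nat.card (Hyperoct n) : F) ≠ 0) (p : CompIndex n)
    (hp : ∀ g, component F p ≤ (component F p).comap (faceRep F n g)) :
    Representation.IsIrreducible (k := F) (G := Hyperoct n) (V := component F p)
      ((faceRep F n).subrepresentation (component F p) hp) := by
  have hinj := (component F p).injective_subtype
  refine { exists_pair_ne := ⟨⊥, ⊤, fun h => component_ne_bot hF h2 p ?_⟩,
           eq_bot_or_eq_top := fun S => ?_ }
  · have h' : (⊥ : Submodule F (component F p)) = ⊤ :=
      congrArg Subrepresentation.toSubmodule h
    rw [← Submodule.map_subtype_top (component F p), ← h', Submodule.map_bot]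
  · have hS := eq_bot_or_eq_component hF h2 hG p
      (Submodule.map_subtype_le (component F p) S.toSubmodule) (by
        rintro g _ ⟨w, hw, rfl⟩
        exact ⟨_, S.apply_mem_toSubmodule g hw, rfl⟩)
    refine hS.imp (fun h => Subrepresentation.toSubmodule_injective ?_)
      fun h => Subrepresentation.toSubmodule_injective ?_
    · exact Submodule.map_injective_of_injective hinj (h.trans (Submodule.map_bot _).symm)
    · exact Submodule.map_injective_of_injective hinj
        (h.trans (Submodule.map_subtype_top (component F p)).symm)

/-- An isomorphism extends to an equivariant endomorphism, whose part from `p` to `q` is zero for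
unlinked pairs. For linked pairs the links in both directions are injective, so the dimensions agree
and a link is an isomorphism. -/
theorem nonempty_equiv_component_iff (hF : ∀ m : ℕ, 0 < m → m ≤ n → (m : F) ≠ 0)
    (h2 : (2 : F) ≠ 0) (hG : (Nat.card (Hyperoct n) : F) ≠ 0) (p q : CompIndex n)
    (hp : ∀ g, component F p ≤ (component F p).comap (faceRep F n g))
    (hq : ∀ g, component F q ≤ (component F q).comap (faceRep F n g)) :
    Nonempty (((faceRep F n).subrepresentation (component F p) hp).Equiv
      ((faceRep F n).subrepresentation (component F q) hq)) ↔ (p, q) ∈ linkedPairs n := by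
  constructor
  · rintro ⟨e⟩
    by_contra hpq
    obtain ⟨-, π, -, hπ, hscal⟩ := incidenceAlgebra_eq_and_scalar (F := F) (n := n) hF h2
    obtain ⟨T, hT, hTe, -⟩ := exists_equivariant_extension hG
      ((faceRep F n).subrepresentation (component F p) hp) (component F p).subtype
      ((component F q).subtype ∘ₗ e.toLinearEquiv.toLinearMap)
      (component F p).injective_subtype (fun g x => rfl)
      (fun g x => congrArg Subtype.val
        (LinearMap.congr_fun (e.toIntertwiningMap.isIntertwining' g) x))
    obtain ⟨v, hv, hv0⟩ := (Submodule.ne_bot_iff _).1 (component_ne_bot (F := F) hF h2 p)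
    have hTv : T v = (e.toLinearEquiv ⟨v, hv⟩ : component F q) := hTe ⟨v, hv⟩
    obtain ⟨c, hc⟩ := hscal T hT p q
    have h1 := hc v hv
    rw [if_neg hpq, smul_zero, hTv, hπ q q _ (e.toLinearEquiv ⟨v, hv⟩).2, if_pos rfl] at h1
    have h3 : e.toLinearEquiv ⟨v, hv⟩ = 0 := Subtype.ext h1
    rw [LinearEquiv.map_eq_zero_iff] at h3
    exact hv0 (congrArg Subtype.val h3)
  · intro h
    have h' : (q, p) ∈ linkedPairs n := by
      simp only [Finset.mem_filter, Finset.mem_univ, true_and] at h ⊢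
      exact h.symm
    have hinj : ∀ {p q : CompIndex n} (h : (p, q) ∈ linkedPairs n), Function.Injective
        ((link F p q).restrict fun v hv => (link_apply_mem hF h2 h hv).1 :
          component F p →ₗ[F] component F q) := by
      intro p q h
      rw [injective_iff_map_eq_zero]
      rintro ⟨v, hv⟩ hv0
      by_contra hne
      exact (link_apply_mem hF h2 h hv).2 (fun h0 => hne (Subtype.ext h0))
        (congrArg Subtype.val hv0)
    have hdim : Module.finrank F (component F p) = Module.finrank F (component F q) :=
      le_antisymm (LinearMap.finrank_le_finrank_of_injective (hinj h))
        (LinearMap.finrank_le_finrank_of_injective (hinj h'))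
    let f : component F p →ₗ[F] component F q :=
      (link F p q).restrict fun v hv => (link_apply_mem hF h2 h hv).1
    let L : component F p ≃ₗ[F] component F q := LinearEquiv.ofBijective f ⟨hinj h,
      (LinearMap.injective_iff_surjective_of_finrank_eq_finrank (V := component F p)
        (V₂ := component F q) hdim).1 (hinj h)⟩
    exact ⟨.mk L fun g => LinearMap.ext fun v => Subtype.ext
        (apply_faceRep (incidenceAlgebra_le (link_mem p q)) g v.1)⟩

/-- Within one level the only component linked to `p` is `p` itself, so all other parts of `T v`
vanish. -/
theorem scalar_on_component (hF : ∀ m : ℕ, 0 < m → m ≤ n → (m : F) ≠ 0) (h2 : (2 : F) ≠ 0)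
    {k : ℕ} {T : Module.End F (FaceModule F n)} (hT : T ∈ equivariantEnd F n)
    (hTk : ∀ v ∈ faceSub F n k, T v ∈ faceSub F n k) (p : CompIndex n) (hp : (p.1.1 : ℕ) = k) :
    ∃ c : F, ∀ v ∈ component F p, T v = c • v := by
  obtain ⟨-, π, -, hπ, hscal⟩ := incidenceAlgebra_eq_and_scalar (F := F) (n := n) hF h2
  have hsum : ∀ u ∈ faceSub F n k,
      u = ∑ q : {q : CompIndex n // (q.1.1 : ℕ) = k}, π q.1 u := by
    have hle : faceSub F n k ≤ LinearMap.eqLocus (LinearMap.id : Module.End F (FaceModule F n))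
        (∑ q : {q : CompIndex n // (q.1.1 : ℕ) = k}, π q.1) := by
      refine (faceSub_le_iSup_component hF h2).trans (iSup_le fun q v hv => ?_)
      rw [LinearMap.mem_eqLocus, LinearMap.sum_apply, Finset.sum_eq_single q]
      · rw [hπ q.1 q.1 v hv, if_pos rfl, LinearMap.id_apply]
      · intro q' _ hne
        rw [hπ q'.1 q.1 v hv, if_neg fun h => hne (Subtype.ext h.symm)]
      · simp
    intro u hu
    have := hle hu
    rwa [LinearMap.mem_eqLocus, LinearMap.sum_apply, LinearMap.id_apply] at this
  obtain ⟨c, hc⟩ := hscal T hT p p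
  refine ⟨c, fun v hv => ?_⟩
  have hvk : v ∈ faceSub F n k := by
    rw [← hp]
    exact specE_le_faceSub _ _ (specEI_le_specE _ _ _ hv)
  have hcv := hc v hv
  rw [if_pos (by simp), link_self, Module.End.one_apply] at hcv
  rw [hsum _ (hTk v hvk), Finset.sum_eq_single ⟨p, hp⟩, hcv]
  · rintro ⟨q, hq⟩ _ hne
    obtain ⟨c', hc'⟩ := hscal T hT p q
    have hpq : (p, q) ∉ linkedPairs n := by
      simp only [Finset.mem_filter, Finset.mem_univ, true_and]
      intro h
      exact hne (Subtype.ext (Subtype.ext (Prod.ext (Fin.ext (hq.trans hp.symm)) h.symm)))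
    rw [hc' v hv, if_neg hpq, smul_zero]
  · simp

theorem commute_on_faceSub (hF : ∀ m : ℕ, 0 < m → m ≤ n → (m : F) ≠ 0) (h2 : (2 : F) ≠ 0)
    {k : ℕ} {T T' : Module.End F (FaceModule F n)} (hT : T ∈ equivariantEnd F n)
    (hT' : T' ∈ equivariantEnd F n) (hTk : ∀ v ∈ faceSub F n k, T v ∈ faceSub F n k)
    (hTk' : ∀ v ∈ faceSub F n k, T' v ∈ faceSub F n k) {v : FaceModule F n}
    (hv : v ∈ faceSub F n k) : T (T' v) = T' (T v) := by
  have hle : faceSub F n k ≤ LinearMap.eqLocus (T * T') (T' * T) := by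
    refine (faceSub_le_iSup_component hF h2).trans (iSup_le ?_)
    rintro ⟨p, hp⟩ v hv
    obtain ⟨c, hc⟩ := scalar_on_component hF h2 hT hTk p hp
    obtain ⟨c', hc'⟩ := scalar_on_component hF h2 hT' hTk' p hp
    rw [LinearMap.mem_eqLocus, Module.End.mul_apply, Module.End.mul_apply, hc v hv, hc' v hv,
      map_smul, map_smul, hc v hv, hc' v hv, smul_comm]
  exact hle hv

/-- Extend `e` to `Φ` and take an equivariant projection `P` onto `S`. They commute on `M_k`, being
scalar on its components, so for `t = Φ s` one gets `P t = Φ (P s) = t`, that is, `t ∈ S`. -/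
theorem subrepresentation_le_of_equiv (hF : ∀ m : ℕ, 0 < m → m ≤ n → (m : F) ≠ 0)
    (h2 : (2 : F) ≠ 0) (hG : (Nat.card (Hyperoct n) : F) ≠ 0) {k : ℕ}
    (hk : ∀ g, faceSub F n k ≤ (faceSub F n k).comap (faceRep F n g))
    (S T : Subrepresentation ((faceRep F n).subrepresentation (faceSub F n k) hk))
    (e : S.toRepresentation.Equiv T.toRepresentation) : T.toSubmodule ≤ S.toSubmodule := by
  obtain ⟨Φ, hΦ, hΦS, hΦr⟩ := exists_equivariant_extension hG S.toRepresentation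
    ((faceSub F n k).subtype ∘ₗ S.toSubmodule.subtype)
    ((faceSub F n k).subtype ∘ₗ T.toSubmodule.subtype ∘ₗ e.toLinearEquiv.toLinearMap)
    ((faceSub F n k).injective_subtype.comp S.toSubmodule.injective_subtype) (fun _ _ => rfl)
    (fun g x => congrArg (fun t : T.toSubmodule => t.1.1)
      (LinearMap.congr_fun (e.toIntertwiningMap.isIntertwining' g) x))
  obtain ⟨P, hP, hPS, hPr⟩ := exists_equivariant_extension hG S.toRepresentation
    ((faceSub F n k).subtype ∘ₗ S.toSubmodule.subtype)
    ((faceSub F n k).subtype ∘ₗ S.toSubmodule.subtype)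
    ((faceSub F n k).injective_subtype.comp S.toSubmodule.injective_subtype) (fun _ _ => rfl)
    (fun _ _ => rfl)
  have hΦk : ∀ v ∈ faceSub F n k, Φ v ∈ faceSub F n k := fun v _ => by
    obtain ⟨x, hx⟩ := hΦr v
    rw [hx]
    exact (e.toLinearEquiv x).1.2
  have hPk : ∀ v ∈ faceSub F n k, P v ∈ faceSub F n k := fun v _ => by
    obtain ⟨x, hx⟩ := hPr v
    rw [hx]
    exact x.1.2
  intro t ht
  set s := e.toLinearEquiv.symm ⟨t, ht⟩ with hs
  have h1 : Φ s.1.1 = t.1 := by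
    have : Φ s.1.1 = (e.toLinearEquiv s).1.1 := hΦS s
    rw [this, hs, LinearEquiv.apply_symm_apply]
  have h3 : P s.1.1 = s.1.1 := hPS s
  have h4 := commute_on_faceSub hF h2 hP hΦ hPk hΦk s.1.2
  rw [h3, h1] at h4
  obtain ⟨x, hx⟩ := hPr t.1
  rw [h4] at hx
  have : t = x.1 := Subtype.ext hx
  rw [this]
  exact x.2

theorem faceSub_isMultiplicityFree (hF : ∀ m : ℕ, 0 < m → m ≤ n → (m : F) ≠ 0)
    (h2 : (2 : F) ≠ 0) (hG : (Nat.card (Hyperoct n) : F) ≠ 0) (k : ℕ)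
    (hk : ∀ g, faceSub F n k ≤ (faceSub F n k).comap (faceRep F n g)) :
    IsMultiplicityFree (F := F) (G := Hyperoct n) (V := faceSub F n k)
      ((faceRep F n).subrepresentation (faceSub F n k) hk) := by
  have : NeZero (Nat.card (Hyperoct n) : F) := ⟨hG⟩
  have hss : ∀ {V : Type _} [AddCommGroup V] [Module F V]
      (ρ : Representation F (Hyperoct n) V), ρ.IsSemisimpleRepresentation :=
    fun _ => inferInstance
  refine ⟨hss (V := faceSub F n k) _, fun S T _ _ ⟨e⟩ => Subrepresentation.toSubmodule_injective ?_⟩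
  exact le_antisymm (subrepresentation_le_of_equiv hF h2 hG hk T S e.symm)
    (subrepresentation_le_of_equiv hF h2 hG hk S T e)

end Irreducibility

theorem theorem1p2 {F : Type*} [Field F] (p : ℕ) [CharP F p] (n : ℕ) (hn : 1 ≤ n)
    (hp : p = 0 ∨ n < p) (hp2 : p ≠ 2) :
    -- `M_k` is the direct sum of the eigenspaces `E_{k,j}` of `σ`, for the eigenvalues `k - 2j`
    (∀ k ≤ n, IsEigenspaceDecomposition (sigmaMap F n) (faceSub F n k)
      (fun j : Fin (k + 1) => (k : F) - 2 * ((j : ℕ) : F))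
      (fun j : Fin (k + 1) => specE F n k j)) ∧
    -- `E_{k,j}` is the direct sum of the eigenspaces `E_{k,j,i}` of `ν⁺`
    (∀ k ≤ n, ∀ j ≤ k, IsEigenspaceDecomposition (nuPlus F n) (specE F n k j)
      (fun i : Fin (min (k - j) (n - k) + 1) => specLam F n k j i)
      (fun i : Fin (min (k - j) (n - k) + 1) => specEI F n k j i)) ∧
    -- all these spaces are `B_n`-submodules, and
    ∃ (hM : ∀ k g, faceSub F n k ≤ (faceSub F n k).comap (faceRep F n g))
      (_ : ∀ k j g, specE F n k j ≤ (specE F n k j).comap (faceRep F n g))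
      (hE : ∀ k j i g, specEI F n k j i ≤ (specEI F n k j i).comap (faceRep F n g)),
      -- the `E_{k,j,i}` are irreducible
      (∀ k ≤ n, ∀ j ≤ k, ∀ i ≤ min (k - j) (n - k),
        Representation.IsIrreducible (k := F) (G := Hyperoct n) (V := specEI F n k j i)
          ((faceRep F n).subrepresentation (specEI F n k j i) (hE k j i))) ∧
      -- `E_{k,j,i}` and `E_{k',j',i'}` are isomorphic exactly if `j = j'` and `i = i'`
      (∀ k ≤ n, ∀ j ≤ k, ∀ i ≤ min (k - j) (n - k),
        ∀ k' ≤ n, ∀ j' ≤ k', ∀ i' ≤ min (k' - j') (n - k'),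
        (Nonempty
          (((faceRep F n).subrepresentation (specEI F n k j i) (hE k j i)).Equiv
            ((faceRep F n).subrepresentation (specEI F n k' j' i') (hE k' j' i'))) ↔
          j = j' ∧ i = i')) ∧
      -- `M_k` is multiplicity free
      (∀ k ≤ n, IsMultiplicityFree (F := F) (G := Hyperoct n) (V := faceSub F n k)
        ((faceRep F n).subrepresentation (faceSub F n k) (hM k))) ∧
      -- the maps `ε_k`, `∂_k` and `id_{M_k}` generate the algebra of `B_n`-endomorphisms of `M^n`
      Algebra.adjoin F {T : Module.End F (FaceModule F n) |
          ∃ k ≤ n, T = epsAt F n k ∨ T = delAt F n k ∨ T = idAt F n k} =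
        Subalgebra.centralizer F (Set.range (faceRep F n)) := by
  have hF : ∀ m : ℕ, 0 < m → m ≤ n → (m : F) ≠ 0 := by
    intro m h0 hm h
    have hdvd := (CharP.cast_eq_zero_iff F p m).1 h
    rcases hp with rfl | hp
    · exact h0.ne' (Nat.zero_dvd.1 hdvd)
    · exact absurd (Nat.le_of_dvd h0 hdvd) (by omega)
  have h2 : (2 : F) ≠ 0 := by
    intro h
    have hdvd := (CharP.cast_eq_zero_iff F p 2).1 (by exact_mod_cast h)
    rcases (Nat.dvd_prime Nat.prime_two).1 hdvd with h1 | h1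
    · exact CharP.char_ne_one F p h1
    · exact hp2 h1
  have hG : (Nat.card (Hyperoct n) : F) ≠ 0 := by
    intro h
    have hdvd := (CharP.cast_eq_zero_iff F p _).1 h
    rcases CharP.char_is_prime_or_zero F p with hpr | rfl
    · exact not_prime_dvd_card_hyperoct hpr (hp.resolve_left hpr.ne_zero) hp2 hdvd
    · exact Nat.card_pos.ne' (Nat.zero_dvd.1 hdvd)
  let idx : ∀ k ≤ n, ∀ j ≤ k, ∀ i ≤ min (k - j) (n - k), CompIndex n :=
    fun k hk j hj i hi => ⟨(⟨k, by omega⟩, ⟨j, by omega⟩, ⟨i, by omega⟩), by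
      constructor <;> dsimp only <;> omega⟩
  refine ⟨fun k hk => sigmaMap_decomposition hF h2 hk,
    fun k hk j hj => nuPlus_decomposition hF h2 hk hj,
    fun k g _ hf => faceRep_mem_faceSub k g hf,
    fun k j g _ hf => faceRep_mem_specE hF h2 k j g hf,
    fun k j i g _ hf => faceRep_mem_specEI hF h2 k j i g hf,
    fun k hk j hj i hi => component_isIrreducible hF h2 hG (idx k hk j hj i hi) _,
    fun k hk j hj i hi k' hk' j' hj' i' hi' => ?_,
    fun k _ => faceSub_isMultiplicityFree hF h2 hG k _,
    (incidenceAlgebra_eq_and_scalar hF h2).1⟩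
  refine (nonempty_equiv_component_iff hF h2 hG (idx k hk j hj i hi)
    (idx k' hk' j' hj' i' hi') _ _).trans ?_
  simp [idx]
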